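/- Let $K$ be an algebraically closed field of characteristic $0$, let $W_1=\operatorname{Der}K[t,t^{-1}]$ and $e_n=t^{n+1}\frac{d}{dt}$ for $n\in\mathbb Z$. The span of $e_{-1},e_0,e_1$ is a subalgebra of $W_1$ isomorphic to $\mathfrak{sl}_2$. Weights of $\mathfrak{sl}_2$-modules are eigenvalues of $e_0$, and highest weight vectors are those annihilated by $e_1$. Let $C=e_0^2+e_0-e_{-1}e_1\in U(\mathfrak{sl}_2)$ be the Casimir element and $U(\gamma)=U(\mathfrak{sl}_2)/\langle C-\gamma\rangle$ for $\gamma\in K$. For $\alpha\in K$ let $N(\alpha)=K[t,t^{-1}]\otimes K^2$, where $K^2$ has basis $v,u$; put $v_k=t^k\otimes v$, $u_k=t^k\otimes u$. It is the gauge module over $W_1$ with the action $$e_nv_k=(k+\alpha n)v_{n+k}+u_{n+k},\qquad e_nu_k=(k+\alpha n)u_{n+k}+v_{n+k+1}\qquad(n,k\in\mathbb Z),$$ which is given by the matrix $B=\begin{pmatrix}0&t\\1&0\end{pmatrix}$, with the identity of $\mathfrak{gl}_1$ acting on $K^2$ as $\alpha$. On $N(\alpha)$ the element $C$ acts as $\alpha(\alpha-1)$,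 so that $N(\alpha)$ is a $U(\alpha(\alpha-1))$-module. **Theorem.** (a) Let $\alpha=0$. (i) The vector $v_0\in N(0)$ is annihilated by $s=e_{-1}e_0-1\in U(0)$. (ii) The $\mathfrak{sl}_2$-submodule $M\subset N(0)$ generated by $v_0$ is a simple $\mathfrak{sl}_2$-module, and $M\cong U(0)/U(0)s$. (iii) The set $\{v_0,\ e_0^nv_0,\ e_{-1}^nv_0\mid n\ge1\}$ is a basis of $M$ (the listed vectors being pairwise distinct). (iv) The quotient $N(0)/M$ is a simple highest weight $\mathfrak{sl}_2$-module with highest weight $-1$; it is isomorphic to the Verma module $U(\mathfrak{sl}_2)/\bigl(U(\mathfrak{sl}_2)e_1+U(\mathfrak{sl}_2)(e_0+1)\bigr)$. (v) $N(0)$ is irreducible as a $W_1$-module. (b) Let $\alpha\notin\frac12\mathbb Z$ and $\gamma=\alpha(\alpha-1)$. (i) The vector $v_0\in N(\alpha)$ is annihilated by the elements $p=e_1-e_0^2(e_0-1+\alpha)$ and $q=e_{-1}e_0^2-(e_0+1-\alpha)$ of $U(\gamma)$. (ii) $N(\alpha)$ is a simple $\mathfrak{sl}_2$-module, and $N(\alpha)\cong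 U(\gamma)/\bigl(U(\gamma)p+U(\gamma)q\bigr)$. (iii) $N(\alpha)$ is irreducible as a $W_1$-module. -/

import Mathlib

open scoped TensorProduct

noncomputable section

namespace CircleGauge

open LaurentPolynomial

/-! ### The algebra of functions on the circle and its Lie algebra of vector fields -/

/-- The algebra `𝒜 = K[t, t⁻¹]`; the variable `t` is `T 1`, and `T n = tⁿ`. -/
abbrev Alg (K : Type*) [Field K] : Type _ := LaurentPolynomial K

/-- The Lie algebra `W₁ = Der K[t, t⁻¹]`, with the commutator bracket. -/
abbrev W1 (K : Type*) [Field K] : Type _ := Derivation K (Alg K) (Alg K)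

variable (K : Type*) [Field K]

/-- The `K`-linear map `tⁿ ↦ n tⁿ⁻¹`. -/
def ddtLin : Alg K →ₗ[K] Alg K :=
  (AddMonoidAlgebra.basis ℤ K).constr K fun n => (n : K) • (T (n - 1) : Alg K)

theorem ddtLin_T (n : ℤ) : ddtLin K (T n) = (n : K) • T (n - 1) := by
  have h : (T n : Alg K) = AddMonoidAlgebra.basis ℤ K n := by
    rw [AddMonoidAlgebra.basis_apply]; rfl
  rw [h, ddtLin, Module.Basis.constr_basis]

theorem alg_induction {P : Alg K → Prop} (hT : ∀ n, P (T n)) (hadd : ∀ x y, P x → P y → P (x + y))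
    (hsmul : ∀ (c : K) x, P x → P (c • x)) (x : Alg K) : P x := by
  refine LaurentPolynomial.induction_on' x (fun p q => hadd p q) (fun n a => ?_)
  rw [← LaurentPolynomial.smul_eq_C_mul]
  exact hsmul a _ (hT n)

theorem ddtLin_leibniz (a b : Alg K) :
    ddtLin K (a * b) = a • ddtLin K b + b • ddtLin K a := by
  induction a using alg_induction with
  | hT m =>
    induction b using alg_induction with
    | hT n =>
      rw [← T_add, ddtLin_T, ddtLin_T, ddtLin_T, smul_eq_mul, smul_eq_mul, mul_smul_comm,
        mul_smul_comm, ← T_add, ← T_add]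
      have h1 : m + (n - 1) = m + n - 1 := by ring
      have h2 : n + (m - 1) = m + n - 1 := by ring
      rw [h1, h2, ← add_smul]
      push_cast
      rw [add_comm (m : K)]
    | hadd x y hx hy => simp only [mul_add, map_add, hx, hy, smul_eq_mul, add_mul]; ring
    | hsmul c x hx => simp only [mul_smul_comm, map_smul, hx, smul_eq_mul, smul_add, smul_mul_assoc]
  | hadd x y hx hy => simp only [add_mul, map_add, hx, hy, smul_eq_mul, mul_add]; ring
  | hsmul c x hx => simp only [smul_mul_assoc, map_smul, hx, smul_eq_mul, smul_add, mul_smul_comm]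

/-- The derivation `d/dt` of `K[t, t⁻¹]`. -/
def ddt : W1 K := Derivation.mk' (ddtLin K) (ddtLin_leibniz K)

theorem ddt_T (n : ℤ) : ddt K (T n) = (n : K) • T (n - 1) := ddtLin_T K n

/-- The vector field `eₙ = tⁿ⁺¹ d/dt`. -/
def e (n : ℤ) : W1 K := (T (n + 1) : Alg K) • ddt K

theorem e_T (n k : ℤ) : e K n (T k) = (k : K) • T (n + k) := by
  rw [e, Derivation.smul_apply, ddt_T, smul_eq_mul, mul_smul_comm, ← T_add]
  congr 2; ring

variable {K}

theorem der_ext {D E : W1 K} (h : D (T 1) = E (T 1)) : D = E := by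
  have key : ∀ (F : W1 K) (n : ℤ), F (T n) = (n : K) • (T (n - 1) * F (T 1)) := by
    intro F n
    have hpos : ∀ n : ℕ, F (T n) = (n : K) • (T ((n : ℤ) - 1) * F (T 1)) := by
      intro n
      induction n with
      | zero => simp
      | succ n ih =>
        push_cast
        rw [T_add, Derivation.leibniz, ih, smul_eq_mul, smul_eq_mul, mul_smul_comm, ← mul_assoc,
          ← T_add, add_smul, one_smul, add_comm]
        have h1 : 1 + ((n : ℤ) - 1) = n := by ring
        have h2 : (n : ℤ) + 1 - 1 = n := by ring
        rw [h1, h2]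
    obtain ⟨m, rfl | rfl⟩ := n.eq_nat_or_neg
    · exact_mod_cast hpos m
    · have h0 : F (T (m : ℤ) * T (-(m : ℤ))) = 0 := by
        rw [← T_add, add_neg_cancel, T_zero]; simp
      rw [Derivation.leibniz, hpos] at h0
      have h1 := congrArg (fun x => T (-(m : ℤ)) * x) h0
      simp only [smul_eq_mul, mul_add, mul_zero, mul_smul_comm, ← mul_assoc, ← T_add,
        neg_add_cancel, T_zero, one_mul] at h1
      rw [eq_neg_of_add_eq_zero_left h1]
      push_cast
      rw [neg_smul]
      congr 4
      ring
  refine Derivation.ext fun x => ?_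
  induction x using alg_induction with
  | hT n => rw [key D, key E, h]
  | hadd x y hx hy => rw [map_add, map_add, hx, hy]
  | hsmul c x hx => rw [Derivation.map_smul, Derivation.map_smul, hx]

theorem eq_smul_ddt (D : W1 K) : D = D (T 1) • ddt K := by
  apply der_ext
  rw [Derivation.smul_apply, ddt_T]
  simp

theorem lie_e_e (m n : ℤ) : ⁅e K m, e K n⁆ = ((n : K) - m) • e K (m + n) := by
  apply der_ext
  rw [Derivation.commutator_apply, Derivation.smul_apply, e_T, e_T, e_T]
  simp only [e_T, Int.cast_one, one_smul]
  rw [sub_smul, ← add_assoc, ← add_assoc, add_comm n m]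
  push_cast
  rw [add_smul, add_smul]
  abel

variable (K)

/-! ### The copy of `sl₂` in `W₁` and its universal enveloping algebra -/

/-- The Lie subalgebra of `W₁` spanned by `e₋₁, e₀, e₁`; it is a copy of `sl₂`. -/
def sl2 : LieSubalgebra K (W1 K) where
  toSubmodule := Submodule.span K {e K (-1), e K 0, e K 1}
  lie_mem' := by
    intro x y hx hy
    change x ∈ Submodule.span K _ at hx
    change y ∈ Submodule.span K _ at hy
    change ⁅x, y⁆ ∈ Submodule.span K _
    have hm : ∀ k : ℤ, (k = -1 ∨ k = 0 ∨ k = 1) →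
        e K k ∈ Submodule.span K ({e K (-1), e K 0, e K 1} : Set (W1 K)) := by
      rintro k (rfl | rfl | rfl) <;> exact Submodule.subset_span (by simp)
    have hb : ∀ m n : ℤ, (m = -1 ∨ m = 0 ∨ m = 1) → (n = -1 ∨ n = 0 ∨ n = 1) →
        ⁅e K m, e K n⁆ ∈ Submodule.span K ({e K (-1), e K 0, e K 1} : Set (W1 K)) := by
      intro m n h1 h2
      rw [lie_e_e]
      by_cases h : m = n
      · subst h; simp
      · exact Submodule.smul_mem _ _ (hm _ (by omega))
    have hx' : ∀ z ∈ Submodule.span K ({e K (-1), e K 0, e K 1} : Set (W1 K)),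
        ∀ n : ℤ, (n = -1 ∨ n = 0 ∨ n = 1) →
        ⁅z, e K n⁆ ∈ Submodule.span K ({e K (-1), e K 0, e K 1} : Set (W1 K)) := by
      intro z hz n hn
      induction hz using Submodule.span_induction with
      | mem z hz => rcases hz with rfl | rfl | rfl <;> exact hb _ _ (by simp) hn
      | zero =>
        exact (zero_lie (L := W1 K) (e K n)).symm ▸ Submodule.zero_mem _
      | add a b _ _ h1 h2 =>
        exact (add_lie (L := W1 K) a b (e K n)).symm ▸ Submodule.add_mem _ h1 h2
      | smul c a _ h =>
        exact (smul_lie (L := W1 K) c a (e K n)).symm ▸ Submodule.smul_mem _ c h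
    induction hy using Submodule.span_induction with
    | mem y hy => rcases hy with rfl | rfl | rfl <;> exact hx' x hx _ (by simp)
    | zero =>
      exact (lie_zero (L := W1 K) (M := W1 K) x).symm ▸ Submodule.zero_mem _
    | add a b _ _ h1 h2 =>
      exact (lie_add (L := W1 K) (M := W1 K) x a b).symm ▸ Submodule.add_mem _ h1 h2
    | smul c a _ h =>
      exact (lie_smul (L := W1 K) (M := W1 K) c x a).symm ▸ Submodule.smul_mem _ c h

/-- `e₋₁` as an element of `sl₂`. -/
def sE_neg : sl2 K := ⟨e K (-1), Submodule.subset_span (by simp)⟩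

/-- `e₀` as an element of `sl₂`. -/
def sE_zero : sl2 K := ⟨e K 0, Submodule.subset_span (by simp)⟩

/-- `e₁` as an element of `sl₂`. -/
def sE_one : sl2 K := ⟨e K 1, Submodule.subset_span (by simp)⟩

/-- The universal enveloping algebra `U(sl₂)`. -/
abbrev U : Type _ := UniversalEnvelopingAlgebra K (sl2 K)

/-- The Casimir element `C = e₀² + e₀ - e₋₁ e₁` of `U(sl₂)`. -/
def casimir : U K :=
  UniversalEnvelopingAlgebra.ι K (sE_zero K) ^ 2 + UniversalEnvelopingAlgebra.ι K (sE_zero K) -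
    UniversalEnvelopingAlgebra.ι K (sE_neg K) * UniversalEnvelopingAlgebra.ι K (sE_one K)

variable {K}

/-- The relation `C = γ`. -/
inductive CasimirRel (γ : K) : U K → U K → Prop
  | mk : CasimirRel γ (casimir K) (algebraMap K (U K) γ)

/-- The congruence of the two-sided ideal of `U(sl₂)` generated by `C - γ`. -/
def casimirCon (γ : K) : RingCon (U K) := ringConGen (CasimirRel γ)

/-- The algebra `U(γ) = U(sl₂) / ⟨C - γ⟩`. -/
abbrev Uq (γ : K) : Type _ := (casimirCon γ).Quotient

/-- The quotient map `U(sl₂) → U(γ)`. -/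
def toUq (γ : K) : U K →ₐ[K] Uq γ := RingCon.mkₐ K (casimirCon γ)

/-- The image of `x ∈ sl₂` in `U(γ)`. -/
def uι (γ : K) (x : sl2 K) : Uq γ := toUq γ (UniversalEnvelopingAlgebra.ι K x)

/-! ### Quotients of `U(sl₂)` and `U(γ)` by left ideals, as `sl₂`-modules -/

/-- The quotient `R / I` of a `K`-algebra `R`, equipped with an algebra homomorphism
`j : U(sl₂) → R`, by a left ideal `I`; it is an `sl₂`-module through `j` and left
multiplication. -/
def LeftQuot {R : Type*} [Ring R] [Algebra K R] (_j : U K →ₐ[K] R) (I : Submodule R R) : Type _ :=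
  R ⧸ I

section LeftQuot

variable {R : Type*} [Ring R] [Algebra K R] (j : U K →ₐ[K] R) (I : Submodule R R)

instance : AddCommGroup (LeftQuot j I) := inferInstanceAs (AddCommGroup (R ⧸ I))
instance : Module R (LeftQuot j I) := inferInstanceAs (Module R (R ⧸ I))
instance : Module K (LeftQuot j I) := inferInstanceAs (Module K (R ⧸ I))
instance : IsScalarTower K R (LeftQuot j I) := inferInstanceAs (IsScalarTower K R (R ⧸ I))

/-- `x ∈ sl₂` acts on `R / I` as left multiplication by its image in `R`. -/
instance : LieRingModule (sl2 K) (LeftQuot j I) where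
  bracket x m := j (UniversalEnvelopingAlgebra.ι K x) • m
  add_lie x y m := by simp only [map_add, add_smul]
  lie_add x m n := smul_add _ _ _
  leibniz_lie x y m := by
    simp only [LieHom.map_lie, LieRing.of_associative_ring_bracket, map_sub, map_mul, sub_smul,
      mul_smul]
    abel

theorem leftQuot_lie (x : sl2 K) (m : LeftQuot j I) :
    ⁅x, m⁆ = j (UniversalEnvelopingAlgebra.ι K x) • m := rfl

instance : LieModule K (sl2 K) (LeftQuot j I) where
  smul_lie c x m := by
    simp only [leftQuot_lie, map_smul, smul_assoc]
  lie_smul c x m := by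
    simp only [leftQuot_lie]
    rw [← algebraMap_smul R c m, ← algebraMap_smul R c, ← mul_smul, ← mul_smul,
      Algebra.commutes]

end LeftQuot

/-- The Verma module of highest weight `μ` with respect to the Borel subalgebra spanned by
`e₀, e₁`, weights being `e₀`-eigenvalues: the quotient of `U(sl₂)` by the left ideal
generated by `e₁` and `e₀ - μ`. -/
abbrev Verma (μ : K) : Type _ :=
  LeftQuot (AlgHom.id K (U K)) (Submodule.span (U K)
    {UniversalEnvelopingAlgebra.ι K (sE_one K),
      UniversalEnvelopingAlgebra.ι K (sE_zero K) - algebraMap K (U K) μ})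

/-- `M` is a highest weight `sl₂`-module of highest weight `μ`: it is generated by a nonzero
vector which is annihilated by `e₁` and on which `e₀` acts as `μ`. -/
def IsHighestWeight (M : Type*) [AddCommGroup M] [Module K M] [LieRingModule (sl2 K) M]
    [LieModule K (sl2 K) M] (μ : K) : Prop :=
  ∃ w : M, w ≠ 0 ∧ ⁅sE_one K, w⁆ = 0 ∧ ⁅sE_zero K, w⁆ = μ • w ∧
    LieSubmodule.lieSpan K (sl2 K) {w} = ⊤

/-! ### The gauge modules -/

/-- The underlying space `N(α) = K[t, t⁻¹] ⊗ K²` of the gauge module. -/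
def N (_α : K) : Type _ := Alg K ⊗[K] (Fin 2 → K)

namespace N

variable (α : K)

instance : AddCommGroup (N α) := inferInstanceAs (AddCommGroup (Alg K ⊗[K] (Fin 2 → K)))
instance : Module (Alg K) (N α) := inferInstanceAs (Module (Alg K) (Alg K ⊗[K] (Fin 2 → K)))
instance : Module K (N α) := inferInstanceAs (Module K (Alg K ⊗[K] (Fin 2 → K)))
instance : IsScalarTower K (Alg K) (N α) :=
  inferInstanceAs (IsScalarTower K (Alg K) (Alg K ⊗[K] (Fin 2 → K)))

/-- The element `g ⊗ w` of `N(α)`. -/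
def mk (g : Alg K) (w : Fin 2 → K) : N α := g ⊗ₜ[K] w

/-- The basis vector `v_k = tᵏ ⊗ v`, where `v = (1, 0)`. -/
def v (k : ℤ) : N α := mk α (T k) ![1, 0]

/-- The basis vector `u_k = tᵏ ⊗ u`, where `u = (0, 1)`. -/
def u (k : ℤ) : N α := mk α (T k) ![0, 1]

/-- The standard `K[t, t⁻¹]`-basis `1 ⊗ v, 1 ⊗ u` of `N(α)`. -/
def stdBasis : Module.Basis (Fin 2) (Alg K) (N α) :=
  Algebra.TensorProduct.basis (Alg K) (Pi.basisFun K (Fin 2))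

/-- The matrix `B` with rows `(0, t)` and `(1, 0)`. -/
def matB : Matrix (Fin 2) (Fin 2) (Alg K) := !![0, T 1; 1, 0]

/-- The gauge field attached to `d/dt`, the `K[t, t⁻¹]`-linear operator `t⁻¹ (B - α)`; that is,
`B` is the zeroth-order part of the gauge field attached to `t d/dt`, up to the shift by `α`. -/
def gauge : N α →ₗ[Alg K] N α :=
  (T (-1) : Alg K) • (Matrix.toLin (stdBasis α) (stdBasis α) matB -
    algebraMap K (Alg K) α • LinearMap.id)

/-- A derivation of `K[t, t⁻¹]` applied to the first tensor factor. -/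
def der (D : W1 K) : N α →ₗ[K] N α :=
  LinearMap.rTensor (Fin 2 → K) (D : Alg K →ₗ[K] Alg K)

/-- The action of a vector field on the gauge module:
`(f d/dt)(g ⊗ w) = f g' ⊗ w + f g 𝐁 w + α f' g ⊗ w`, where `𝐁` is the gauge field and
`f = D(t)` for `D = f d/dt`. -/
def act (D : W1 K) (m : N α) : N α :=
  der α D m + D (T 1) • gauge α m + (α • ddt K (D (T 1))) • m

variable {α}

theorem induction {P : N α → Prop} (h0 : P 0) (hmk : ∀ g w, P (mk α g w))
    (hadd : ∀ x y, P x → P y → P (x + y)) (x : N α) : P x :=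
  TensorProduct.induction_on (motive := P) x h0 hmk hadd

theorem smul_mk (f g : Alg K) (w : Fin 2 → K) : f • mk α g w = mk α (f * g) w := rfl

theorem der_mk (D : W1 K) (g : Alg K) (w : Fin 2 → K) :
    der α D (mk α g w) = mk α (D g) w := rfl

theorem mk_add (f g : Alg K) (w : Fin 2 → K) : mk α (f + g) w = mk α f w + mk α g w :=
  TensorProduct.add_tmul f g w

theorem der_smul (D : W1 K) (f : Alg K) (m : N α) :
    der α D (f • m) = D f • m + f • der α D m := by
  induction m using induction with
  | h0 => simp
  | hmk g w =>
    rw [smul_mk, der_mk, der_mk, smul_mk, smul_mk, Derivation.leibniz, mk_add, smul_eq_mul,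
      smul_eq_mul, add_comm, mul_comm g]
  | hadd x y hx hy => simp only [smul_add, map_add, hx, hy]; abel

theorem der_eq (D : W1 K) (m : N α) : der α D m = D (T 1) • der α (ddt K) m := by
  induction m using induction with
  | h0 => simp
  | hmk g w =>
    rw [der_mk, der_mk, smul_mk]
    conv_lhs => rw [eq_smul_ddt D]
    rfl
  | hadd x y hx hy => simp only [smul_add, map_add, hx, hy]

/-- The covariant derivative `d/dt + 𝐁`. -/
def nabla (m : N α) : N α := der α (ddt K) m + gauge α m

theorem nabla_add (m n : N α) : nabla (m + n) = nabla m + nabla n := by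
  simp only [nabla, map_add]; abel

theorem nabla_smul (f : Alg K) (m : N α) : nabla (f • m) = ddt K f • m + f • nabla m := by
  simp only [nabla, der_smul, map_smul, smul_add]; abel

theorem act_eq (D : W1 K) (m : N α) :
    act α D m = D (T 1) • nabla m + (α • ddt K (D (T 1))) • m := by
  rw [act, der_eq, nabla, smul_add]

theorem der_apply_eq (D : W1 K) (a : Alg K) : D a = D (T 1) * ddt K a := by
  conv_lhs => rw [eq_smul_ddt D]
  rfl

/-- `N(α)` is a module over `W₁`. -/
instance : LieRingModule (W1 K) (N α) where
  bracket D m := act α D m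
  add_lie D E m := by
    simp only [act_eq, Derivation.add_apply, map_add, smul_add, add_smul]; abel
  lie_add D m n := by
    simp only [act_eq, nabla_add, smul_add]; abel
  leibniz_lie D E m := by
    simp only [act_eq, nabla_add, nabla_smul, Derivation.commutator_apply, smul_add, smul_smul,
      Derivation.map_smul, map_sub]
    simp only [der_apply_eq D (E (T 1)), der_apply_eq E (D (T 1)), Derivation.leibniz, smul_eq_mul,
      Algebra.smul_def α]
    module

theorem lie_def (D : W1 K) (m : N α) : ⁅D, m⁆ = act α D m := rfl

instance : LieModule K (W1 K) (N α) where
  smul_lie c D m := by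
    simp only [lie_def, act_eq, Derivation.smul_apply, smul_add, smul_assoc]
    rw [Derivation.map_smul, smul_assoc, smul_comm α c]
  lie_smul c D m := by
    have h : nabla (c • m) = c • nabla m := by
      rw [← algebraMap_smul (Alg K) c m, nabla_smul, Derivation.map_algebraMap, zero_smul,
        zero_add, algebraMap_smul]
    simp only [lie_def, act_eq, h, smul_add]
    rw [smul_comm c, smul_comm c]

theorem stdBasis_zero : stdBasis α 0 = v α 0 := by
  rw [v, T_zero, stdBasis]
  refine (Algebra.TensorProduct.basis_apply _ _).trans ?_
  rw [mk]
  congr 1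
  ext i
  fin_cases i <;> simp

theorem stdBasis_one : stdBasis α 1 = u α 0 := by
  rw [u, T_zero, stdBasis]
  refine (Algebra.TensorProduct.basis_apply _ _).trans ?_
  rw [mk]
  congr 1
  ext i
  fin_cases i <;> simp

theorem T_smul_v (n k : ℤ) : (T n : Alg K) • v α k = v α (n + k) := by
  rw [v, v, smul_mk, T_add]

theorem T_smul_u (n k : ℤ) : (T n : Alg K) • u α k = u α (n + k) := by
  rw [u, u, smul_mk, T_add]

theorem gauge_v_zero : gauge α (v α 0) = u α (-1) - α • v α (-1) := by
  have h : Matrix.toLin (stdBasis α) (stdBasis α) matB (v α 0) = u α 0 := by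
    rw [← stdBasis_zero, Matrix.toLin_self, Fin.sum_univ_two, stdBasis_one]
    simp [matB]
  simp only [gauge, LinearMap.smul_apply, LinearMap.sub_apply, LinearMap.id_apply, h, smul_sub,
    T_smul_u, algebraMap_smul]
  rw [smul_comm, T_smul_v, add_zero]

theorem gauge_u_zero : gauge α (u α 0) = v α 0 - α • u α (-1) := by
  have h : Matrix.toLin (stdBasis α) (stdBasis α) matB (u α 0) = v α 1 := by
    rw [← stdBasis_one, Matrix.toLin_self, Fin.sum_univ_two, stdBasis_zero]
    simp [matB, T_smul_v]
  simp only [gauge, LinearMap.smul_apply, LinearMap.sub_apply, LinearMap.id_apply, h, smul_sub,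
    T_smul_v, algebraMap_smul]
  rw [smul_comm, T_smul_u, add_zero, neg_add_cancel]

theorem nabla_v (k : ℤ) : nabla (v α k) = ((k : K) - α) • v α (k - 1) + u α (k - 1) := by
  have h : v α k = (T k : Alg K) • v α 0 := by rw [T_smul_v, add_zero]
  have h0 : der α (ddt K) (v α 0) = 0 := by
    rw [v, der_mk, ddt_T, Int.cast_zero, zero_smul]; exact TensorProduct.zero_tmul _ _
  rw [h, nabla_smul, nabla, h0, gauge_v_zero, ddt_T, smul_assoc, T_smul_v, zero_add, smul_sub,
    smul_comm, T_smul_v, T_smul_u, add_zero, ← sub_eq_add_neg]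
  module

theorem nabla_u (k : ℤ) : nabla (u α k) = ((k : K) - α) • u α (k - 1) + v α k := by
  have h : u α k = (T k : Alg K) • u α 0 := by rw [T_smul_u, add_zero]
  have h0 : der α (ddt K) (u α 0) = 0 := by
    rw [u, der_mk, ddt_T, Int.cast_zero, zero_smul]; exact TensorProduct.zero_tmul _ _
  rw [h, nabla_smul, nabla, h0, gauge_u_zero, ddt_T, smul_assoc, T_smul_u, zero_add, smul_sub,
    smul_comm, T_smul_v, T_smul_u, add_zero, add_zero, ← sub_eq_add_neg]
  module

/-- `eₙ v_k = (k + α n) v_{n+k} + u_{n+k}`. -/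
theorem lie_e_v (n k : ℤ) :
    ⁅e K n, v α k⁆ = ((k : K) + α * n) • v α (n + k) + u α (n + k) := by
  rw [lie_def, act_eq, nabla_v, e_T, Int.cast_one, one_smul, ddt_T, smul_add, smul_comm, T_smul_v,
    T_smul_u, smul_assoc, smul_assoc, T_smul_v]
  have h1 : n + 1 + (k - 1) = n + k := by ring
  have h2 : n + 1 - 1 + k = n + k := by ring
  rw [h1, h2]
  push_cast
  module

/-- `eₙ u_k = (k + α n) u_{n+k} + v_{n+k+1}`. -/
theorem lie_e_u (n k : ℤ) :
    ⁅e K n, u α k⁆ = ((k : K) + α * n) • u α (n + k) + v α (n + k + 1) := by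
  rw [lie_def, act_eq, nabla_u, e_T, Int.cast_one, one_smul, ddt_T, smul_add, smul_comm, T_smul_v,
    T_smul_u, smul_assoc, smul_assoc, T_smul_u]
  have h1 : n + 1 + (k - 1) = n + k := by ring
  have h2 : n + 1 - 1 + k = n + k := by ring
  have h3 : n + 1 + k = n + k + 1 := by ring
  rw [h1, h2, h3]
  push_cast
  module

/-- The vectors `v_k, u_k` span `N(α)` over `K`. -/
theorem vu_induction {P : N α → Prop} (hv : ∀ k, P (v α k)) (hu : ∀ k, P (u α k))
    (hadd : ∀ x y, P x → P y → P (x + y)) (hsmul : ∀ (c : K) x, P x → P (c • x)) (x : N α) :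
    P x := by
  induction x using induction with
  | h0 => simpa using hsmul 0 _ (hv 0)
  | hmk g w =>
    induction g using alg_induction with
    | hT n =>
      have h : mk α (T n) w = w 0 • v α n + w 1 • u α n := by
        have hw : w = w 0 • ![1, 0] + w 1 • ![0, 1] := by
          ext i
          fin_cases i <;> simp
        conv_lhs => rw [hw]
        exact (TensorProduct.tmul_add _ _ _).trans
          (congrArg₂ (· + ·) (TensorProduct.tmul_smul _ _ _) (TensorProduct.tmul_smul _ _ _))
      rw [h]
      exact hadd _ _ (hsmul _ _ (hv n)) (hsmul _ _ (hu n))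
    | hadd f g hf hg => rw [mk_add]; exact hadd _ _ hf hg
    | hsmul c g hg => exact hsmul c (mk α g w) hg
  | hadd x y hx hy => exact hadd _ _ hx hy

theorem lie_sE (x : sl2 K) (m : N α) : ⁅x, m⁆ = ⁅(x : W1 K), m⁆ := rfl

/-- The representation of `U(sl₂)` on `N(α)`. -/
def repU (α : K) : U K →ₐ[K] Module.End K (N α) :=
  UniversalEnvelopingAlgebra.lift K (LieModule.toEnd K (sl2 K) (N α))

theorem repU_ι (x : sl2 K) (m : N α) :
    repU α (UniversalEnvelopingAlgebra.ι K x) m = ⁅(x : W1 K), m⁆ := by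
  rw [repU, UniversalEnvelopingAlgebra.lift_ι_apply]; rfl

/-- The Casimir element acts on `N(α)` as multiplication by `α (α - 1)`. -/
theorem repU_casimir (α : K) :
    repU α (casimir K) = algebraMap K (Module.End K (N α)) (α * (α - 1)) := by
  ext m
  simp only [casimir, map_sub, map_add, map_mul, pow_two, LinearMap.sub_apply, LinearMap.add_apply,
    Module.End.mul_apply, repU_ι, Module.algebraMap_end_apply, sE_zero, sE_neg, sE_one]
  induction m using vu_induction with
  | hv k =>
    simp only [lie_e_v, lie_e_u, lie_add, lie_smul, zero_add]
    have h1 : -1 + (1 + k) = k := by ring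
    rw [h1]
    push_cast
    module
  | hu k =>
    simp only [lie_e_v, lie_e_u, lie_add, lie_smul, zero_add]
    have h1 : -1 + (1 + k) = k := by ring
    have h2 : -1 + (1 + k + 1) = k + 1 := by ring
    rw [h1, h2]
    push_cast
    module
  | hadd x y hx hy =>
    refine Eq.trans ?_ ((congrArg₂ (· + ·) hx hy).trans ?_)
    · simp only [lie_add]
      abel
    · module
  | hsmul c x hx =>
    refine Eq.trans ?_ ((congrArg (c • ·) hx).trans ?_)
    · simp only [lie_smul]
      module
    · module

/-- For `γ = α (α - 1)`, the representation of `U(γ)` on `N(α)` induced by the action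
of `sl₂`. -/
def rep (α γ : K) (h : γ = α * (α - 1)) : Uq γ →ₐ[K] Module.End K (N α) :=
  RingCon.liftₐ (casimirCon γ) (repU α) (by
    rw [casimirCon]
    refine RingCon.ringConGen_le.mpr ?_
    intro a b hab
    cases hab
    change repU α _ = repU α _
    rw [repU_casimir, AlgHom.commutes, h])

/-- `x ∈ sl₂ ⊂ U(γ)` acts on `N(α)` in the same way as `x ∈ W₁`. -/
theorem rep_uι (α γ : K) (h : γ = α * (α - 1)) (x : sl2 K) (m : N α) :
    rep α γ h (uι γ x) m = ⁅(x : W1 K), m⁆ :=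
  repU_ι x m

end N

/-- The `sl₂`-submodule of `N(0)` generated by `v₀`. -/
def M (K : Type*) [Field K] : LieSubmodule K (sl2 K) (N (0 : K)) :=
  LieSubmodule.lieSpan K (sl2 K) {N.v 0 0}

/-- The element `s = e₋₁ e₀ - 1` of `U(0)`. -/
def elS (K : Type*) [Field K] : Uq (0 : K) :=
  uι 0 (sE_neg K) * uι 0 (sE_zero K) - 1

/-- The element `p = e₁ - e₀² (e₀ - 1 + α)` of `U(γ)`. -/
def elP (α γ : K) : Uq γ :=
  uι γ (sE_one K) - uι γ (sE_zero K) ^ 2 * (uι γ (sE_zero K) - 1 + algebraMap K (Uq γ) α)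

/-- The element `q = e₋₁ e₀² - (e₀ + 1 - α)` of `U(γ)`. -/
def elQ (α γ : K) : Uq γ :=
  uι γ (sE_neg K) * uι γ (sE_zero K) ^ 2 - (uι γ (sE_zero K) + 1 - algebraMap K (Uq γ) α)

end CircleGauge

end

open CircleGauge

/-! Everything is read off from the action of `K[e₀]`. In `N(α)` one has `v_{k+1} = (e₀ - k)² v_k`,
and `e₀` has no eigenvectors, so `N(α)` is a torsion-free `K[e₀]`-module of rank one. Moreover `e₁
f(e₀) = f(e₀ - 1) e₁` and `e₋₁ f(e₀) = f(e₀ + 1) e₋₁`.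

Simplicity. For a nonzero submodule `P`, the ideal of all `f` with `f(e₀) v₀ ∈ P` is nonzero, so its
zero set is finite. Acting by `e₋₁` and `e₁` shows that this set is closed under `x ↦ x + 1` except
at `α - 1`, and under `x ↦ x - 1` except at `0` and `1 - α`. A nonempty finite set must be left in
both directions, which would put `α` or `2α` in `ℤ` (`Ideal.eq_top_of_shift`). So if `2α ∉ ℤ`, then
`v₀ ∈ P`, and `v₀` generates everything. For `α = 0` the relation `e₋₁ e₀ v₀ = v₀` removes the
exception to `x ↦ x + 1`: every nonzero submodule contains `v₀`, so `M` is simple, and `eₙ v₀ = uₙ`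
yields irreducibility over `W₁`.

Presentations. The relation `s`, or the relations `p` and `q`, make the quotient by the left ideal
an ascending union of cyclic `K[e₀]`-modules (`exists_eq_polyAct_negPow`,
`exists_eq_polyAct_chain`). The map to `N(α)` is nonzero on each generator of the chain and its
target is torsion-free, so it is injective.

The quotient `N(0)/M`. The class of `v₋₁` is a nonzero highest weight vector of weight `-1` that
generates it. A module generated by such a vector is simple, so the Verma module maps isomorphically
onto `N(0)/M`. -/

noncomputable section

namespace CircleGauge

open Polynomial LieModule

/-! ### Brackets of the generators of `sl₂`. -/

section Generators

variable {K : Type*} [Field K]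

theorem lie_sE_one_sE_zero : ⁅sE_one K, sE_zero K⁆ = -sE_one K := by
  apply Subtype.ext
  rw [LieSubalgebra.coe_bracket]
  change ⁅e K 1, e K 0⁆ = -e K 1
  rw [lie_e_e, add_zero]
  push_cast
  module

theorem lie_sE_neg_sE_zero : ⁅sE_neg K, sE_zero K⁆ = sE_neg K := by
  apply Subtype.ext
  rw [LieSubalgebra.coe_bracket]
  change ⁅e K (-1), e K 0⁆ = e K (-1)
  rw [lie_e_e]
  simp

theorem lie_sE_one_sE_neg : ⁅sE_one K, sE_neg K⁆ = (-2 : K) • sE_zero K := by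
  apply Subtype.ext
  rw [LieSubalgebra.coe_bracket]
  change ⁅e K 1, e K (-1)⁆ = (-2 : K) • e K 0
  rw [lie_e_e]
  norm_num

theorem sl2_induction {P : sl2 K → Prop} (hneg : P (sE_neg K)) (hzero : P (sE_zero K))
    (hone : P (sE_one K)) (h0 : P 0) (hadd : ∀ x y, P x → P y → P (x + y))
    (hsmul : ∀ (c : K) x, P x → P (c • x)) (x : sl2 K) : P x := by
  obtain ⟨x, hx⟩ := x
  have hx' : x ∈ Submodule.span K ({e K (-1), e K 0, e K 1} : Set (W1 K)) := hx
  induction hx' using Submodule.span_induction with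
  | mem z hz => rcases hz with rfl | rfl | rfl <;> assumption
  | zero => exact h0
  | add a b ha hb h1 h2 => exact hadd ⟨a, ha⟩ ⟨b, hb⟩ (h1 ha) (h2 hb)
  | smul c a ha h => exact hsmul c ⟨a, ha⟩ (h ha)

/-- A subspace stable under `e₋₁, e₀, e₁` is an `sl₂`-submodule. -/
def lieSubmoduleOfStable {V : Type*} [AddCommGroup V] [Module K V] [LieRingModule (sl2 K) V]
    [LieModule K (sl2 K) V] (P : Submodule K V) (hneg : ∀ m ∈ P, ⁅sE_neg K, m⁆ ∈ P)
    (hzero : ∀ m ∈ P, ⁅sE_zero K, m⁆ ∈ P) (hone : ∀ m ∈ P, ⁅sE_one K, m⁆ ∈ P) :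
    LieSubmodule K (sl2 K) V where
  toSubmodule := P
  lie_mem := by
    intro x m hm
    change ⁅x, m⁆ ∈ P
    induction x using sl2_induction with
    | hneg => exact hneg m hm
    | hzero => exact hzero m hm
    | hone => exact hone m hm
    | h0 => simp
    | hadd x y hx hy => rw [add_lie]; exact P.add_mem hx hy
    | hsmul c x hx => rw [smul_lie]; exact P.smul_mem c hx

end Generators

/-! ### Polynomials in `e₀`, and chains of cyclic `K[e₀]`-modules. -/

section PolyAct

variable {K : Type*} [Field K] {V : Type*} [AddCommGroup V] [Module K V] [LieRingModule (sl2 K) V]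
  [LieModule K (sl2 K) V]

variable (V) in
/-- The action of polynomials in `e₀` on an `sl₂`-module. -/
def polyAct : K[X] →ₐ[K] Module.End K V := aeval (toEnd K (sl2 K) V (sE_zero K))

theorem polyAct_X (m : V) : polyAct V (X : K[X]) m = ⁅sE_zero K, m⁆ := by
  simp [polyAct]

theorem polyAct_C (c : K) (m : V) : polyAct V (C c) m = c • m := by
  simp [polyAct]

theorem polyAct_mul (f g : K[X]) (m : V) : polyAct V (f * g) m = polyAct V f (polyAct V g m) := by
  rw [map_mul]; rfl

theorem polyAct_add (f g : K[X]) (m : V) : polyAct V (f + g) m = polyAct V f m + polyAct V g m := by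
  rw [map_add]; rfl

theorem polyAct_sub (f g : K[X]) (m : V) : polyAct V (f - g) m = polyAct V f m - polyAct V g m := by
  rw [map_sub]; rfl

theorem polyAct_one (m : V) : polyAct V (1 : K[X]) m = m := by
  rw [map_one]; rfl

theorem polyAct_comm (f g : K[X]) (m : V) :
    polyAct V f (polyAct V g m) = polyAct V g (polyAct V f m) := by
  rw [← polyAct_mul, mul_comm, polyAct_mul]

theorem polyAct_induction {P : K[X] → Prop} (hC : ∀ c, P (C c)) (hadd : ∀ f g, P f → P g → P (f + g))
    (hX : ∀ f, P f → P (X * f)) (f : K[X]) : P f := by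
  induction f using Polynomial.induction_on with
  | C a => exact hC a
  | add f g hf hg => exact hadd f g hf hg
  | monomial n a h =>
    have := hX _ h
    rwa [show X * (C a * X ^ n) = C a * X ^ (n + 1) by ring] at this

/-- Since `e₁ e₀ = (e₀ - 1) e₁`, moving `e₁` past a polynomial in `e₀` shifts its variable. With the
analogue for `e₋₁`, this reduces submodule questions to polynomials. -/
theorem lie_one_polyAct (f : K[X]) (m : V) :
    ⁅sE_one K, polyAct V f m⁆ = polyAct V (f.comp (X - 1)) ⁅sE_one K, m⁆ := by
  induction f using polyAct_induction generalizing m with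
  | hC c => simp [polyAct_C]
  | hadd f g hf hg => simp only [polyAct_add, lie_add, hf, hg, add_comp]
  | hX f hf =>
    rw [polyAct_mul, polyAct_X, mul_comp, X_comp, polyAct_mul, polyAct_sub, polyAct_one,
      polyAct_X, leibniz_lie, lie_sE_one_sE_zero, neg_lie, hf]
    abel

theorem lie_neg_polyAct (f : K[X]) (m : V) :
    ⁅sE_neg K, polyAct V f m⁆ = polyAct V (f.comp (X + 1)) ⁅sE_neg K, m⁆ := by
  induction f using polyAct_induction generalizing m with
  | hC c => simp [polyAct_C]
  | hadd f g hf hg => simp only [polyAct_add, lie_add, hf, hg, add_comp]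
  | hX f hf =>
    rw [polyAct_mul, polyAct_X, mul_comp, X_comp, polyAct_mul, polyAct_add, polyAct_one,
      polyAct_X, leibniz_lie, lie_sE_neg_sE_zero, hf]
    abel

theorem LieSubmodule.polyAct_mem (P : LieSubmodule K (sl2 K) V) (f : K[X]) {m : V} (hm : m ∈ P) :
    polyAct V f m ∈ P := by
  induction f using polyAct_induction with
  | hC c => rw [polyAct_C]; exact P.smul_mem c hm
  | hadd f g hf hg => rw [polyAct_add]; exact P.add_mem hf hg
  | hX f hf => rw [polyAct_mul, polyAct_X]; exact P.lie_mem hf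

theorem LieModuleHom.map_polyAct {V' : Type*} [AddCommGroup V'] [Module K V']
    [LieRingModule (sl2 K) V'] [LieModule K (sl2 K) V'] (φ : V →ₗ⁅K, sl2 K⁆ V') (f : K[X]) (m : V) :
    φ (polyAct V f m) = polyAct V' f (φ m) := by
  induction f using polyAct_induction with
  | hC c => rw [polyAct_C, polyAct_C, map_smul]
  | hadd f g hf hg => rw [polyAct_add, polyAct_add, map_add, hf, hg]
  | hX f hf => rw [polyAct_mul, polyAct_mul, polyAct_X, polyAct_X, φ.map_lie, hf]

/-- If two vectors `f(e₀) m`, `g(e₀) m` with coprime `f, g` lie in a submodule, so does `m`. -/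
theorem LieSubmodule.mem_of_isCoprime (P : LieSubmodule K (sl2 K) V) {f g : K[X]}
    (h : IsCoprime f g) {m : V} (hf : polyAct V f m ∈ P) (hg : polyAct V g m ∈ P) : m ∈ P := by
  obtain ⟨a, b, hab⟩ := h
  rw [← polyAct_one (K := K) m, ← hab, polyAct_add, polyAct_mul, polyAct_mul]
  exact P.add_mem (LieSubmodule.polyAct_mem P a hf) (LieSubmodule.polyAct_mem P b hg)

/-- The Casimir element acts on `V` as multiplication by `γ`. -/
def HasCasimir (K V : Type*) [Field K] [AddCommGroup V] [Module K V] [LieRingModule (sl2 K) V]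
    [LieModule K (sl2 K) V] (γ : K) : Prop :=
  ∀ m : V, ⁅sE_neg K, ⁅sE_one K, m⁆⁆ = polyAct V (X ^ 2 + X - C γ : K[X]) m

/-- Subtract `2 e₀ = [e₋₁, e₁]` from `e₋₁ e₁`. Thus `e₁` undoes `e₋₁` up to a polynomial in `e₀`,
which controls `e₁` on any chain built with `e₋₁`. -/
theorem HasCasimir.one_neg {γ : K} (h : HasCasimir K V γ) (m : V) :
    ⁅sE_one K, ⁅sE_neg K, m⁆⁆ = polyAct V (X ^ 2 - X - C γ : K[X]) m := by
  rw [leibniz_lie, lie_sE_one_sE_neg, h m, smul_lie, ← polyAct_X, ← polyAct_C, ← polyAct_mul,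
    ← polyAct_add]
  congr 2
  have : (C (-2) : K[X]) = -2 := by rw [C_neg, C_ofNat]
  rw [this]
  ring

/-- If `z 0, z 1, …` is an ascending chain of generators of `K[e₀]`-submodules whose union is
stable under `e₋₁` and `e₁`, then the union contains the `sl₂`-submodule generated by `z 0`. -/
theorem exists_polyAct_of_chain (z : ℕ → V) (hz : ∀ n, ∃ f : K[X], z n = polyAct V f (z (n + 1)))
    (hneg : ∀ n, ∃ k, ∃ f : K[X], ⁅sE_neg K, z n⁆ = polyAct V f (z k))
    (hone : ∀ n, ∃ k, ∃ f : K[X], ⁅sE_one K, z n⁆ = polyAct V f (z k))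
    {m : V} (hm : m ∈ LieSubmodule.lieSpan K (sl2 K) {z 0}) :
    ∃ n, ∃ f : K[X], m = polyAct V f (z n) := by
  -- Two elements of the union can be written over a common generator, so the union is closed under
  -- addition.
  have mono : ∀ n k : ℕ, ∃ f : K[X], z n = polyAct V f (z (n + k)) := by
    intro n k
    induction k with
    | zero => exact ⟨1, (polyAct_one _).symm⟩
    | succ k ih =>
      obtain ⟨f, hf⟩ := ih
      obtain ⟨g, hg⟩ := hz (n + k)
      exact ⟨f * g, by rw [polyAct_mul, hf, hg]; rfl⟩
  let Q : Submodule K V :=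
    { carrier := {m | ∃ n, ∃ f : K[X], m = polyAct V f (z n)}
      zero_mem' := ⟨0, 0, by simp⟩
      add_mem' := by
        rintro _ _ ⟨n, f, rfl⟩ ⟨k, g, rfl⟩
        obtain ⟨a, ha⟩ := mono n k
        obtain ⟨b, hb⟩ := mono k n
        refine ⟨n + k, f * a + g * b, ?_⟩
        rw [add_comm k n] at hb
        rw [polyAct_add, polyAct_mul, polyAct_mul, ← ha, ← hb]
      smul_mem' := by
        rintro c _ ⟨n, f, rfl⟩
        exact ⟨n, C c * f, by rw [polyAct_mul, polyAct_C]⟩ }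
  let P : LieSubmodule K (sl2 K) V := lieSubmoduleOfStable Q
    (by
      rintro _ ⟨n, f, rfl⟩
      obtain ⟨k, g, hg⟩ := hneg n
      exact ⟨k, f.comp (X + 1) * g, by rw [lie_neg_polyAct, hg, polyAct_mul]⟩)
    (by
      rintro _ ⟨n, f, rfl⟩
      exact ⟨n, X * f, by rw [polyAct_mul, polyAct_X]⟩)
    (by
      rintro _ ⟨n, f, rfl⟩
      obtain ⟨k, g, hg⟩ := hone n
      exact ⟨k, f.comp (X - 1) * g, by rw [lie_one_polyAct, hg, polyAct_mul]⟩)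
  have hP : LieSubmodule.lieSpan K (sl2 K) {z 0} ≤ P := by
    rw [LieSubmodule.lieSpan_le, Set.singleton_subset_iff]
    exact ⟨0, 1, (polyAct_one _).symm⟩
  exact hP hm

/-- `e₋₁ⁿ m`. -/
def negPow (m : V) (n : ℕ) : V := (toEnd K (sl2 K) V (sE_neg K) ^ n) m

theorem negPow_zero (m : V) : negPow (K := K) m 0 = m := rfl

theorem negPow_succ (m : V) (n : ℕ) : negPow (K := K) m (n + 1) = ⁅sE_neg K, negPow (K := K) m n⁆ := by
  rw [negPow, pow_succ']; rfl

/-- The chain `e₋₁ⁿ m` of a vector `m` with `e₋₁ e₀ m = m`. -/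
theorem polyAct_negPow {m : V} (h : ⁅sE_neg K, ⁅sE_zero K, m⁆⁆ = m) (n : ℕ) :
    polyAct V (X + C (n + 1 : K) : K[X]) (negPow (K := K) m (n + 1)) = negPow (K := K) m n := by
  induction n with
  | zero =>
    rw [← polyAct_X, lie_neg_polyAct, X_comp] at h
    rw [negPow_succ, negPow_zero]
    simpa using h
  | succ n ih =>
    conv_rhs => rw [negPow_succ, ← ih, lie_neg_polyAct, ← negPow_succ]
    congr 2
    simp only [add_comp, X_comp, C_comp, map_add, map_one, Nat.cast_add, Nat.cast_one, one_comp]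
    ring

/-- The vectors `e₋₁ⁿ m` form the chain: `e₋₁` moves one step along it, and the Casimir relation
brings `e₁` one step back. At the start, `e₁ m = e₁ e₋₁ (e₀ m)` is again a polynomial in `e₀`
applied to `m`. -/
theorem exists_eq_polyAct_negPow (hC : HasCasimir K V 0) {m : V}
    (h : ⁅sE_neg K, ⁅sE_zero K, m⁆⁆ = m) {x : V} (hx : x ∈ LieSubmodule.lieSpan K (sl2 K) {m}) :
    ∃ n, ∃ f : K[X], x = polyAct V f (negPow (K := K) m n) := by
  refine exists_polyAct_of_chain (negPow (K := K) m) (fun n => ⟨_, (polyAct_negPow h n).symm⟩)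
    (fun n => ⟨n + 1, 1, by rw [polyAct_one, negPow_succ]⟩) (fun n => ?_) hx
  cases n with
  | zero =>
    refine ⟨0, (X ^ 2 - X - C 0) * X, ?_⟩
    rw [polyAct_mul, negPow_zero, polyAct_X, ← hC.one_neg, h]
  | succ n => exact ⟨n, _, by rw [negPow_succ, hC.one_neg]⟩

theorem isCoprime_X_add_C {a b : K} (h : a ≠ b) (n : ℕ) :
    IsCoprime (X + C a : K[X]) ((X + C b) ^ n) := by
  have := (isCoprime_X_sub_C_of_isUnit_sub (a := -a) (b := -b)
    (IsUnit.mk0 _ (by rw [neg_sub_neg]; exact sub_ne_zero.mpr h.symm))).pow_right (n := n)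
  simpa using this

/-- The chain obtained from the relations `p` and `q`. -/
theorem exists_eq_polyAct_chain {γ α : K} (hC : HasCasimir K V γ) (hα : ∀ n : ℕ, α ≠ -n) {m : V}
    (hp : ⁅sE_one K, m⁆ = polyAct V (X ^ 2 * (X - 1 + C α)) m)
    (hq : ⁅sE_neg K, polyAct V (X ^ 2 : K[X]) m⁆ = polyAct V (X + C (1 - α)) m)
    {x : V} (hx : x ∈ LieSubmodule.lieSpan K (sl2 K) {m}) :
    ∃ y : V, ∃ f g : K[X], x = polyAct V f y ∧ polyAct V g y = m := by
  -- The model is `z n = v₋ₙ` in `N(α)`, where `(e₀ + n + 1)² v₋ₙ₋₁ = v₋ₙ` and `(e₀ + 1 - α) v₋ₙ₋₁ =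
  -- e₋₁ v₋ₙ`. A Bézout identity for the two polynomials recovers `v₋ₙ₋₁` from the right-hand sides;
  -- the same formula defines `z (n + 1)` in any `V`.
  have hcop : ∀ n : ℕ, IsCoprime (X + C (1 - α) : K[X]) ((X + C (n + 1 : K)) ^ 2) := fun n =>
    isCoprime_X_add_C (fun h => hα n (by linear_combination -h)) 2
  choose a b hab using hcop
  let z : ℕ → V := fun n => Nat.rec m (fun n y =>
    polyAct V (a n) ⁅sE_neg K, y⁆ + polyAct V (b n) y) n
  have z0 : z 0 = m := rfl
  have zs : ∀ n, z (n + 1) = polyAct V (a n) ⁅sE_neg K, z n⁆ + polyAct V (b n) (z n) :=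
    fun n => rfl
  have step : ∀ n : ℕ, polyAct V ((X + C (n + 1 : K)) ^ 2) ⁅sE_neg K, z n⁆
        = polyAct V (X + C (1 - α)) (z n) →
      polyAct V ((X + C (n + 1 : K)) ^ 2) (z (n + 1)) = z n ∧
      polyAct V (X + C (1 - α)) (z (n + 1)) = ⁅sE_neg K, z n⁆ := by
    intro n hn
    constructor
    · rw [zs, map_add, polyAct_comm, hn, ← polyAct_mul, ← polyAct_mul, ← polyAct_add,
        mul_comm _ (b n), hab, polyAct_one]
    · rw [zs, map_add, polyAct_comm _ (b n), ← hn, ← polyAct_mul, ← polyAct_mul, ← polyAct_add,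
        mul_comm _ (a n), hab, polyAct_one]
  -- This is the compatibility needed for both equations to have a common solution `z (n + 1)`. It
  -- starts from `q` and propagates by applying `e₋₁` to `(e₀ + n + 1)² z (n + 1) = z n`.
  have key : ∀ n : ℕ, polyAct V ((X + C (n + 1 : K)) ^ 2) ⁅sE_neg K, z n⁆
        = polyAct V (X + C (1 - α)) (z n) := by
    intro n
    induction n with
    | zero =>
      rw [z0, ← hq, lie_neg_polyAct]
      simp
    | succ n ih =>
      obtain ⟨h1, h2⟩ := step n ih
      rw [h2]
      conv_rhs => rw [← h1, lie_neg_polyAct]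
      congr 2
      simp only [add_comp, X_comp, C_comp, map_add, map_one, Nat.cast_add, Nat.cast_one, one_comp,
        pow_comp]
      ring
  have hone : ∀ n, ∃ f : K[X], ⁅sE_one K, z n⁆ = polyAct V f (z n) := by
    intro n
    induction n with
    | zero => exact ⟨_, hp⟩
    | succ n ih =>
      obtain ⟨f, hf⟩ := ih
      refine ⟨((a n).comp (X - 1) * (X ^ 2 - X - C γ) + (b n).comp (X - 1) * f) *
        (X + C (n + 1 : K)) ^ 2, ?_⟩
      rw [polyAct_mul, (step n (key n)).1, zs, lie_add, lie_one_polyAct, lie_one_polyAct,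
        hC.one_neg, hf, polyAct_add, polyAct_mul, polyAct_mul]
  have hz : ∀ n, ∃ f : K[X], z n = polyAct V f (z (n + 1)) :=
    fun n => ⟨_, (step n (key n)).1.symm⟩
  obtain ⟨n, f, hf⟩ := exists_polyAct_of_chain z hz
    (fun n => ⟨n + 1, _, (step n (key n)).2.symm⟩)
    (fun n => ⟨n, hone n⟩) hx
  have hg : ∃ g : K[X], polyAct V g (z n) = m := by
    clear hf
    induction n with
    | zero => exact ⟨1, polyAct_one _⟩
    | succ n ih =>
      obtain ⟨g, hg⟩ := ih
      exact ⟨g * (X + C (n + 1 : K)) ^ 2, by rw [polyAct_mul, (step n (key n)).1, hg]⟩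
  obtain ⟨g, hg⟩ := hg
  exact ⟨z n, f, g, hf, hg⟩

end PolyAct

/-! ### Modules generated by a highest weight vector of weight `-1`. -/

section HighestWeight

variable {K : Type*} [Field K] {V : Type*} [AddCommGroup V] [Module K V]
  [LieRingModule (sl2 K) V] [LieModule K (sl2 K) V]

theorem lie_zero_negPow {w : V} (hzero : ⁅sE_zero K, w⁆ = (-1 : K) • w) (n : ℕ) :
    ⁅sE_zero K, negPow (K := K) w n⁆ = (-(n + 1) : K) • negPow (K := K) w n := by
  induction n with
  | zero => rw [negPow_zero, hzero]; simp
  | succ n ih =>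
    have h := leibniz_lie (sE_neg K) (sE_zero K) (negPow (K := K) w n)
    rw [lie_sE_neg_sE_zero, ih, lie_smul, ← negPow_succ] at h
    rw [← sub_eq_iff_eq_add'] at h
    rw [← h]
    push_cast
    module

/-- Each passage of `e₁` across `e₋₁` contributes `-2 e₀`, and `e₀` acts on `e₋₁ⁱ w` as `-(i + 1)`;
these contributions add up to `(n + 1)(n + 2)`. The coefficient never vanishes in characteristic
zero, which makes the module simple. -/
theorem lie_one_negPow {w : V} (hone : ⁅sE_one K, w⁆ = 0) (hzero : ⁅sE_zero K, w⁆ = (-1 : K) • w)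
    (n : ℕ) : ⁅sE_one K, negPow (K := K) w (n + 1)⁆ =
      ((n + 1) * (n + 2) : K) • negPow (K := K) w n := by
  induction n with
  | zero =>
    rw [negPow_succ, negPow_zero, leibniz_lie, lie_sE_one_sE_neg, hone, smul_lie, hzero, lie_zero]
    push_cast
    module
  | succ n ih =>
    rw [negPow_succ, leibniz_lie, lie_sE_one_sE_neg, ih, smul_lie, lie_smul, ← negPow_succ,
      lie_zero_negPow hzero]
    push_cast
    module

theorem mem_span_negPow {w : V} (hone : ⁅sE_one K, w⁆ = 0)
    (hzero : ⁅sE_zero K, w⁆ = (-1 : K) • w) {x : V}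
    (hx : x ∈ LieSubmodule.lieSpan K (sl2 K) {w}) :
    x ∈ Submodule.span K (Set.range (negPow (K := K) w)) := by
  have stable : ∀ y : sl2 K,
      (∀ n, ⁅y, negPow (K := K) w n⁆ ∈ Submodule.span K (Set.range (negPow (K := K) w))) →
      ∀ m ∈ Submodule.span K (Set.range (negPow (K := K) w)),
        ⁅y, m⁆ ∈ Submodule.span K (Set.range (negPow (K := K) w)) := by
    intro y hy m hm
    induction hm using Submodule.span_induction with
    | mem m hm => obtain ⟨n, rfl⟩ := hm; exact hy n
    | zero => rw [lie_zero]; exact Submodule.zero_mem _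
    | add a b _ _ ha hb => rw [lie_add]; exact Submodule.add_mem _ ha hb
    | smul c a _ ha => rw [lie_smul]; exact Submodule.smul_mem _ c ha
  have hmem : ∀ n, negPow (K := K) w n ∈ Submodule.span K (Set.range (negPow (K := K) w)) :=
    fun n => Submodule.subset_span ⟨n, rfl⟩
  let P : LieSubmodule K (sl2 K) V := lieSubmoduleOfStable _
    (stable (sE_neg K) fun n => by rw [← negPow_succ]; exact hmem _)
    (stable (sE_zero K) fun n => by
      rw [lie_zero_negPow hzero]; exact Submodule.smul_mem _ _ (hmem _))
    (stable (sE_one K) fun n => by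
      cases n with
      | zero => rw [negPow_zero, hone]; exact Submodule.zero_mem _
      | succ n => rw [lie_one_negPow hone hzero]; exact Submodule.smul_mem _ _ (hmem _))
  have hP : LieSubmodule.lieSpan K (sl2 K) {w} ≤ P := by
    rw [LieSubmodule.lieSpan_le, Set.singleton_subset_iff]
    exact hmem 0
  exact hP hx

/-- An `sl₂`-module generated by a nonzero highest weight vector of weight `-1` is simple. -/
theorem isIrreducible_of_highestWeight [CharZero K] {w : V} (hw : w ≠ 0) (hone : ⁅sE_one K, w⁆ = 0)
    (hzero : ⁅sE_zero K, w⁆ = (-1 : K) • w) (hgen : LieSubmodule.lieSpan K (sl2 K) {w} = ⊤) :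
    LieModule.IsIrreducible K (sl2 K) V := by
  have : Nontrivial V := ⟨w, 0, hw⟩
  let E : Module.End K V := toEnd K (sl2 K) V (sE_one K)
  have hE : ∀ n, ∃ c : K, c ≠ 0 ∧ (E ^ n) (negPow (K := K) w n) = c • w := by
    intro n
    induction n with
    | zero => exact ⟨1, one_ne_zero, by rw [one_smul]; rfl⟩
    | succ n ih =>
      obtain ⟨c, hc, h⟩ := ih
      refine ⟨(n + 1) * (n + 2) * c, mul_ne_zero (mul_ne_zero ?_ ?_) hc, ?_⟩
      · exact_mod_cast n.succ_ne_zero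
      · exact_mod_cast (n + 1).succ_ne_zero
      · rw [pow_succ, Module.End.mul_apply, toEnd_apply_apply, lie_one_negPow hone hzero, map_smul,
          h, smul_smul]
  have hE' : ∀ n i, i < n → (E ^ n) (negPow (K := K) w i) = 0 := by
    intro n i hi
    obtain ⟨c, -, h⟩ := hE i
    obtain ⟨k, rfl⟩ := Nat.exists_eq_add_of_lt hi
    rw [show i + k + 1 = k + 1 + i by ring, pow_add, Module.End.mul_apply, h, pow_succ,
      Module.End.mul_apply, map_smul, toEnd_apply_apply, hone, smul_zero, map_zero]
  refine LieModule.IsIrreducible.mk fun P hP => ?_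
  obtain ⟨x, hxP, hx⟩ : ∃ x ∈ P, x ≠ 0 := by
    by_contra! h
    exact hP ((LieSubmodule.eq_bot_iff P).mpr h)
  have hxs : x ∈ Submodule.span K (Set.range (negPow (K := K) w)) :=
    mem_span_negPow hone hzero (hgen ▸ LieSubmodule.mem_top x)
  obtain ⟨l, rfl⟩ := Finsupp.mem_span_range_iff_exists_finsupp.mp hxs
  have hl : l.support.Nonempty := by
    rw [Finsupp.support_nonempty_iff]
    rintro rfl
    simp at hx
  -- For the largest index `n` occurring in the vector, `e₁ⁿ` kills every lower term and turns the
  -- top one into a nonzero multiple of `w`.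
  set n := l.support.max' hl
  have hn : l n ≠ 0 := Finsupp.mem_support_iff.mp (l.support.max'_mem hl)
  obtain ⟨c, hc, h⟩ := hE n
  have hsum : (E ^ n) (l.sum fun i a => a • negPow (K := K) w i) = (l n * c) • w := by
    rw [Finsupp.sum, map_sum, Finset.sum_eq_single n]
    · rw [map_smul, h, smul_smul]
    · intro i hi hin
      rw [map_smul, hE' n i (lt_of_le_of_ne (l.support.le_max' i hi) hin), smul_zero]
    · intro hn'
      exact absurd (l.support.max'_mem hl) hn'
  have hEP : ∀ k, (E ^ k) (l.sum fun i a => a • negPow (K := K) w i) ∈ P := by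
    intro k
    induction k with
    | zero => exact hxP
    | succ k ih => rw [pow_succ', Module.End.mul_apply]; exact P.lie_mem ih
  have hwP : w ∈ P := by
    have h1 := P.smul_mem (l n * c)⁻¹ (hsum ▸ hEP n)
    rwa [smul_smul, inv_mul_cancel₀ (mul_ne_zero hn hc), one_smul] at h1
  rw [eq_top_iff, ← hgen, LieSubmodule.lieSpan_le, Set.singleton_subset_iff]
  exact hwP

end HighestWeight

/-! ### Quotients by left ideals as cyclic `sl₂`-modules. -/

section LeftQuot

attribute [local instance] LieRing.ofAssociativeRing LieAlgebra.ofAssociativeAlgebra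

variable {K : Type*} [Field K]

/-- The universal property gives a map from `U(sl₂)` to the subalgebra `S`; followed by the
inclusion of `S` it is the identity, by uniqueness. -/
theorem adjoin_range_ι :
    Algebra.adjoin K (Set.range (UniversalEnvelopingAlgebra.ι K (L := sl2 K))) = ⊤ := by
  set S := Algebra.adjoin K (Set.range (UniversalEnvelopingAlgebra.ι K (L := sl2 K)))
  let f : sl2 K →ₗ⁅K⁆ S :=
    { toFun := fun x => ⟨UniversalEnvelopingAlgebra.ι K x, Algebra.subset_adjoin ⟨x, rfl⟩⟩
      map_add' := fun x y => Subtype.ext (map_add _ x y)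
      map_smul' := fun c x => Subtype.ext (map_smul _ c x)
      map_lie' := fun {x y} => Subtype.ext (LieHom.map_lie _ x y) }
  have h : S.val.comp (UniversalEnvelopingAlgebra.lift K f) = AlgHom.id K (U K) := by
    apply UniversalEnvelopingAlgebra.hom_ext
    ext x
    simp [f]
  rw [eq_top_iff]
  intro u _
  have := congrArg (fun g => g u) h
  simp only [AlgHom.comp_apply, AlgHom.id_apply] at this
  rw [← this]
  exact Subtype.property _

variable {R : Type*} [Ring R] [Algebra K R] (j : U K →ₐ[K] R)

/-- The class of `1` in `R / I`. -/
def LeftQuot.one (I : Submodule R R) : LeftQuot j I := Submodule.Quotient.mk (p := I) 1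

variable {j}

theorem LeftQuot.smul_one_eq_zero {I : Submodule R R} {r : R} (hr : r ∈ I) :
    r • LeftQuot.one j I = 0 := by
  refine Eq.trans ?_ ((Submodule.Quotient.mk_eq_zero I).mpr hr)
  conv_rhs => rw [← mul_one r]
  rfl

theorem LeftQuot.exists_smul_one {I : Submodule R R} (m : LeftQuot j I) :
    ∃ r : R, m = r • LeftQuot.one j I := by
  obtain ⟨r, rfl⟩ := Submodule.Quotient.mk_surjective I m
  refine ⟨r, ?_⟩
  conv_lhs => rw [← mul_one r]
  rfl

theorem LeftQuot.lieSpan_one (hj : Function.Surjective j) (I : Submodule R R) :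
    LieSubmodule.lieSpan K (sl2 K) {LeftQuot.one j I} = ⊤ := by
  rw [eq_top_iff]
  rintro m -
  obtain ⟨r, rfl⟩ := LeftQuot.exists_smul_one m
  obtain ⟨x, rfl⟩ := hj r
  have hx : x ∈ Algebra.adjoin K (Set.range (UniversalEnvelopingAlgebra.ι K (L := sl2 K))) := by
    rw [adjoin_range_ι]; trivial
  set P := LieSubmodule.lieSpan K (sl2 K) {LeftQuot.one j I}
  have key : ∀ y ∈ P, j x • y ∈ P := by
    induction hx using Algebra.adjoin_induction with
    | mem x hx => obtain ⟨x, rfl⟩ := hx; exact fun y hy => P.lie_mem hy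
    | algebraMap c =>
      intro y hy
      rw [AlgHom.commutes, algebraMap_smul]
      exact P.smul_mem c hy
    | add a b _ _ ha hb =>
      intro y hy
      rw [map_add, add_smul]
      exact P.add_mem (ha y hy) (hb y hy)
    | mul a b _ _ ha hb =>
      intro y hy
      rw [map_mul, mul_smul]
      exact ha _ (hb y hy)
  exact key _ (LieSubmodule.subset_lieSpan rfl)

/-- The annihilator of `v` is a left ideal containing `S`. The map is descended over `K`, as `R`
acts on `V` only through `ρ`. -/
theorem LeftQuot.exists_hom {V : Type*} [AddCommGroup V] [Module K V] [LieRingModule (sl2 K) V]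
    [LieModule K (sl2 K) V] (ρ : R →ₐ[K] Module.End K V)
    (hρ : ∀ x m, ρ (j (UniversalEnvelopingAlgebra.ι K x)) m = ⁅x, m⁆) {S : Set R} {v : V}
    (hS : ∀ s ∈ S, ρ s v = 0) :
    ∃ φ : LeftQuot j (Submodule.span R S) →ₗ⁅K, sl2 K⁆ V, φ (LeftQuot.one j _) = v := by
  let f : R →ₗ[K] V := (LinearMap.applyₗ v).comp ρ.toLinearMap
  have hf : ∀ r, f r = ρ r v := fun r => rfl
  have hker : (Submodule.span R S).restrictScalars K ≤ LinearMap.ker f := by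
    intro r hr
    rw [Submodule.restrictScalars_mem] at hr
    rw [LinearMap.mem_ker, hf]
    induction hr using Submodule.span_induction with
    | mem s hs => exact hS s hs
    | zero => simp
    | add a b _ _ ha hb => rw [map_add, LinearMap.add_apply, ha, hb, add_zero]
    | smul a b _ hb => rw [smul_eq_mul, map_mul, Module.End.mul_apply, hb, map_zero]
  let g : LeftQuot j (Submodule.span R S) →ₗ[K] V :=
    (((Submodule.span R S).restrictScalars K).liftQ f hker).comp
      (Submodule.Quotient.restrictScalarsEquiv K (Submodule.span R S)).symm.toLinearMap
  have hg : ∀ r : R, g (r • LeftQuot.one j _) = ρ r v := by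
    intro r
    refine Eq.trans ?_ (hf r)
    conv_rhs => rw [← mul_one r]
    rfl
  refine ⟨{ toLinearMap := g, map_lie' := ?_ }, ?_⟩
  · intro x m
    obtain ⟨r, rfl⟩ := LeftQuot.exists_smul_one m
    change g ⁅x, r • LeftQuot.one j _⁆ = ⁅x, g (r • LeftQuot.one j _)⁆
    rw [leftQuot_lie, smul_smul, hg, hg, map_mul, Module.End.mul_apply, hρ]
  · change g _ = v
    rw [← one_smul R (LeftQuot.one j _), hg, map_one, Module.End.one_apply]

theorem LeftQuot.polyAct_eq {I : Submodule R R} (f : K[X]) (m : LeftQuot j I) :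
    polyAct (LeftQuot j I) f m =
      aeval (j (UniversalEnvelopingAlgebra.ι K (sE_zero K))) f • m := by
  induction f using polyAct_induction with
  | hC c => rw [polyAct_C, aeval_C, algebraMap_smul]
  | hadd f g hf hg => rw [polyAct_add, hf, hg, map_add, add_smul]
  | hX f hf => rw [polyAct_mul, polyAct_X, hf, map_mul, aeval_X, mul_smul, leftQuot_lie]

theorem toUq_surjective (γ : K) : Function.Surjective (toUq γ) :=
  RingCon.mkₐ_surjective (casimirCon γ)

theorem toUq_casimir (γ : K) : toUq γ (casimir K) = algebraMap K (Uq γ) γ := by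
  rw [← AlgHom.commutes (toUq γ) γ]
  exact (RingCon.eq (casimirCon γ)).mpr (RingConGen.Rel.of _ _ CasimirRel.mk)

theorem LeftQuot.hasCasimir {γ : K} (I : Submodule (Uq γ) (Uq γ)) :
    HasCasimir K (LeftQuot (toUq γ) I) γ := by
  intro m
  have h := toUq_casimir γ
  rw [casimir, map_sub, map_add, map_pow, map_mul] at h
  rw [LeftQuot.polyAct_eq, leftQuot_lie, leftQuot_lie, smul_smul]
  congr 1
  rw [map_sub, map_add, map_pow, aeval_X, aeval_C, ← h]
  abel

end LeftQuot

/-! ### The structure of `N(α)` over `K[e₀]`. -/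

namespace N

variable {K : Type*} [Field K] {α : K}

variable (K) in
/-- The `K`-basis of `K[t, t⁻¹] ⊗ K²` made up of the `tᵏ ⊗ v` (at `2k`) and the `tᵏ ⊗ u`
(at `2k + 1`). -/
def tensorBasis : Module.Basis ℤ K (Alg K ⊗[K] (Fin 2 → K)) :=
  ((AddMonoidAlgebra.basis ℤ K).tensorProduct (Pi.basisFun K (Fin 2))).reindex
    (Int.divModEquiv 2).symm

theorem tensorBasis_apply (k : ℤ) (i : Fin 2) :
    tensorBasis K (2 * k + i) = (LaurentPolynomial.T k : Alg K) ⊗ₜ[K] Pi.single i (1 : K) := by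
  have h : Int.divModEquiv 2 (2 * k + i) = (k, i) := by
    rw [← Equiv.eq_symm_apply, Int.divModEquiv_symm_apply]
    simp [mul_comm]
  rw [tensorBasis, Module.Basis.reindex_apply, Equiv.symm_symm, h,
    Module.Basis.tensorProduct_apply, AddMonoidAlgebra.basis_apply, Pi.basisFun_apply]
  rfl

variable (α) in
/-- The `K`-basis `w` of `N(α)` with `w (2k) = v_k` and `w (2k + 1) = u_k`. -/
def basisW : Module.Basis ℤ K (N α) := tensorBasis K

theorem basisW_two_mul (k : ℤ) : basisW α (2 * k) = v α k := by
  have h := tensorBasis_apply (K := K) k 0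
  rw [show (Pi.single 0 1 : Fin 2 → K) = ![1, 0] by ext i; fin_cases i <;> simp,
    show 2 * k + ((0 : Fin 2) : ℕ) = 2 * k by simp] at h
  exact h

theorem basisW_two_mul_add_one (k : ℤ) : basisW α (2 * k + 1) = u α k := by
  have h := tensorBasis_apply (K := K) k 1
  rw [show (Pi.single 1 1 : Fin 2 → K) = ![0, 1] by ext i; fin_cases i <;> simp,
    show 2 * k + ((1 : Fin 2) : ℕ) = 2 * k + 1 by simp] at h
  exact h

theorem basisW_induction {P : N α → Prop} (hw : ∀ j, P (basisW α j))
    (hadd : ∀ x y, P x → P y → P (x + y)) (hsmul : ∀ (c : K) x, P x → P (c • x)) (x : N α) :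
    P x :=
  vu_induction (fun k => basisW_two_mul (α := α) k ▸ hw _)
    (fun k => basisW_two_mul_add_one (α := α) k ▸ hw _) hadd hsmul x

/-- Interleaving the `v_k` and `u_k` gives one formula for both parities, with `j / 2` rounded down.
In this order `e₀` raises the leading index by one. -/
theorem lie_zero_basisW (j : ℤ) : ⁅sE_zero K, basisW α j⁆ =
    ((j / 2 : ℤ) : K) • basisW α j + basisW α (j + 1) := by
  change ⁅e K 0, basisW α j⁆ = _
  obtain ⟨k, rfl | rfl⟩ := j.even_or_odd'
  · rw [basisW_two_mul, basisW_two_mul_add_one, lie_e_v, zero_add]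
    simp
  · rw [show 2 * k + 1 + 1 = 2 * (k + 1) by ring, basisW_two_mul, basisW_two_mul_add_one, lie_e_u,
      zero_add, show (2 * k + 1) / 2 = k by omega]
    simp

theorem lie_neg_basisW (j : ℤ) : ⁅sE_neg K, basisW α j⁆ =
    ((j / 2 : ℤ) - α : K) • basisW α (j - 2) + basisW α (j - 1) := by
  change ⁅e K (-1), basisW α j⁆ = _
  obtain ⟨k, rfl | rfl⟩ := j.even_or_odd'
  · rw [show 2 * k - 2 = 2 * (-1 + k) by ring, show 2 * k - 1 = 2 * (-1 + k) + 1 by ring,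
      basisW_two_mul, basisW_two_mul, basisW_two_mul_add_one, lie_e_v]
    simp [sub_eq_add_neg]
  · rw [show 2 * k + 1 - 2 = 2 * (-1 + k) + 1 by ring, show 2 * k + 1 - 1 = 2 * (-1 + k + 1) by ring,
      basisW_two_mul, basisW_two_mul_add_one, basisW_two_mul_add_one, lie_e_u,
      show (2 * k + 1) / 2 = k by omega]
    simp [sub_eq_add_neg]

theorem repr_lie_zero (m : N α) (j : ℤ) : (basisW α).repr ⁅sE_zero K, m⁆ (j + 1) =
    (((j + 1) / 2 : ℤ) : K) * (basisW α).repr m (j + 1) + (basisW α).repr m j := by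
  induction m using basisW_induction with
  | hw i =>
    rw [lie_zero_basisW]
    simp only [map_add, map_smul, Module.Basis.repr_self, Finsupp.add_apply, Finsupp.smul_apply,
      Finsupp.single_apply, smul_eq_mul, add_left_inj]
    split_ifs with h
    · rw [h]
    · simp
  | hadd x y hx hy => simp only [lie_add, map_add, Finsupp.add_apply, hx, hy]; ring
  | hsmul c x hx => simp only [lie_smul, map_smul, Finsupp.smul_apply, hx, smul_eq_mul]; ring

theorem repr_lie_neg (m : N α) (j : ℤ) : (basisW α).repr ⁅sE_neg K, m⁆ j =
    (((j + 2) / 2 : ℤ) - α : K) * (basisW α).repr m (j + 2) + (basisW α).repr m (j + 1) := by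
  induction m using basisW_induction with
  | hw i =>
    rw [lie_neg_basisW]
    simp only [map_add, map_smul, Module.Basis.repr_self, Finsupp.add_apply, Finsupp.smul_apply,
      Finsupp.single_apply, smul_eq_mul, sub_eq_iff_eq_add]
    congr 1
    split_ifs with h
    · rw [h]
    · simp
  | hadd x y hx hy => simp only [lie_add, map_add, Finsupp.add_apply, hx, hy]; ring
  | hsmul c x hx => simp only [lie_smul, map_smul, Finsupp.smul_apply, hx, smul_eq_mul]; ring

/-- `e₀` has no eigenvectors in `N(α)`. -/
theorem eq_zero_of_lie_zero_eq_smul {m : N α} {c : K} (h : ⁅sE_zero K, m⁆ = c • m) : m = 0 := by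
  by_contra hm
  have hs : ((basisW α).repr m).support.Nonempty := by
    rw [Finsupp.support_nonempty_iff]
    exact fun h0 => hm ((basisW α).repr.map_eq_zero_iff.mp h0)
  set n := ((basisW α).repr m).support.max' hs
  have hn : (basisW α).repr m n ≠ 0 := Finsupp.mem_support_iff.mp (Finset.max'_mem _ hs)
  have hn' : (basisW α).repr m (n + 1) = 0 := by
    by_contra h1
    have := Finset.le_max' _ _ (Finsupp.mem_support_iff.mpr h1)
    exact absurd this (by omega)
  have := repr_lie_zero m n
  -- Compare coefficients just above the top index `n`: that of `e₀ m` is the leading coefficient of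
  -- `m`, that of `c m` is zero.
  rw [h, map_smul, Finsupp.smul_apply, hn', smul_zero, mul_zero, zero_add] at this
  exact hn this.symm

/-- `N(α)` is a torsion-free `K[e₀]`-module. -/
theorem polyAct_injective [IsAlgClosed K] {f : K[X]} (hf : f ≠ 0) {m : N α}
    (h : polyAct (N α) f m = 0) : m = 0 := by
  by_contra hm
  rw [(IsAlgClosed.splits f).eq_prod_roots, polyAct_mul, polyAct_C,
    smul_eq_zero_iff_right (leadingCoeff_ne_zero.mpr hf)] at h
  generalize f.roots = s at h
  induction s using Multiset.induction_on with
  | empty => rw [Multiset.map_zero, Multiset.prod_zero, polyAct_one] at h; exact hm h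
  | cons a s ih =>
    rw [Multiset.map_cons, Multiset.prod_cons, polyAct_mul, polyAct_sub, polyAct_X, polyAct_C,
      sub_eq_zero] at h
    exact ih (eq_zero_of_lie_zero_eq_smul h)

theorem polyAct_eq_iff [IsAlgClosed K] {f g : K[X]} {m : N α} (hm : m ≠ 0) :
    polyAct (N α) f m = polyAct (N α) g m ↔ f = g := by
  refine ⟨fun h => ?_, fun h => by rw [h]⟩
  by_contra hfg
  refine hm (polyAct_injective (sub_ne_zero.mpr hfg) ?_)
  rw [polyAct_sub, h, sub_self]

theorem v_ne_zero (k : ℤ) : v α k ≠ 0 := by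
  rw [← basisW_two_mul]
  exact (basisW α).ne_zero _

theorem hasCasimir (α : K) : HasCasimir K (N α) (α * (α - 1)) := by
  intro m
  have h : repU α (casimir K) m = (α * (α - 1)) • m := by rw [repU_casimir]; rfl
  simp only [casimir, map_sub, map_add, map_mul, pow_two, LinearMap.sub_apply, LinearMap.add_apply,
    Module.End.mul_apply, repU_ι] at h
  rw [polyAct_sub, polyAct_add, polyAct_C, pow_two, polyAct_mul, polyAct_X, polyAct_X, ← h]
  simp only [lie_sE]
  abel

theorem lie_zero_v (k : ℤ) : ⁅sE_zero K, v α k⁆ = (k : K) • v α k + u α k := by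
  refine (lie_e_v 0 k).trans ?_
  simp

theorem lie_zero_u (k : ℤ) : ⁅sE_zero K, u α k⁆ = (k : K) • u α k + v α (k + 1) := by
  refine (lie_e_u 0 k).trans ?_
  simp

theorem lie_one_v (k : ℤ) : ⁅sE_one K, v α k⁆ = (k + α : K) • v α (k + 1) + u α (k + 1) := by
  refine (lie_e_v 1 k).trans ?_
  simp [add_comm]

theorem lie_neg_v (k : ℤ) : ⁅sE_neg K, v α k⁆ = (k - α : K) • v α (k - 1) + u α (k - 1) := by
  refine (lie_e_v (-1) k).trans ?_
  simp [sub_eq_add_neg, add_comm]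

theorem polyAct_v (k : ℤ) : polyAct (N α) (X - C (k : K)) (v α k) = u α k := by
  rw [polyAct_sub, polyAct_C, polyAct_X, lie_zero_v, add_sub_cancel_left]

theorem polyAct_u (k : ℤ) : polyAct (N α) (X - C (k : K)) (u α k) = v α (k + 1) := by
  rw [polyAct_sub, polyAct_C, polyAct_X, lie_zero_u, add_sub_cancel_left]

/-- The operator `e₀ - k` takes `v_k` to `u_k` and `u_k` to `v_{k+1}`. All the `v_k` thus form one
chain over `K[e₀]`. -/
theorem polyAct_sq_v (k : ℤ) : polyAct (N α) ((X - C (k : K)) ^ 2) (v α k) = v α (k + 1) := by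
  rw [pow_two, polyAct_mul, polyAct_v, polyAct_u]

theorem lie_one_v_eq (k : ℤ) : ⁅sE_one K, v α k⁆ = polyAct (N α) (X - 1 + C α) (v α (k + 1)) := by
  rw [lie_one_v, polyAct_add, polyAct_sub, polyAct_one, polyAct_C, polyAct_X, lie_zero_v]
  push_cast
  module

theorem lie_neg_v_eq (k : ℤ) : ⁅sE_neg K, v α k⁆ = polyAct (N α) (X + C (1 - α)) (v α (k - 1)) := by
  rw [lie_neg_v, polyAct_add, polyAct_C, polyAct_X, lie_zero_v]
  push_cast
  module

end N

/-! ### Ideals of `K[X]` under the shifts of the variable by `±1`. -/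

section Shift

theorem Ideal.eq_top_of_no_common_root {K : Type*} [Field K] [IsAlgClosed K] {J : Ideal K[X]}
    (hJ : ∀ x : K, ∃ f ∈ J, f.eval x ≠ 0) : J = ⊤ := by
  set g := Submodule.IsPrincipal.generator J
  have hg : Ideal.span {g} = J := Ideal.span_singleton_generator J
  by_contra hne
  have hu : ¬IsUnit g := fun hu => hne (by rw [← hg, Ideal.span_singleton_eq_top]; exact hu)
  have hdeg : g.degree ≠ 0 ∨ g = 0 := by
    by_contra! h
    exact hu (isUnit_iff_degree_eq_zero.mpr h.1)
  obtain ⟨x, hx⟩ : ∃ x, g.eval x = 0 := by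
    rcases hdeg with h | h
    · exact IsAlgClosed.exists_root g h
    · exact ⟨0, by rw [h, eval_zero]⟩
  obtain ⟨f, hf, hfx⟩ := hJ x
  rw [← hg, Ideal.mem_span_singleton] at hf
  obtain ⟨q, rfl⟩ := hf
  exact hfx (by rw [eval_mul, hx, zero_mul])

variable {K : Type*} [Field K] [CharZero K]

/-- In characteristic zero the progression `x + n c` is infinite, so it must leave `Z`. -/
theorem exists_last_mem_of_finite {Z : Set K} (hZ : Z.Finite) {x : K} (hx : x ∈ Z) {c : K}
    (hc : c ≠ 0) : ∃ n : ℕ, x + n * c ∈ Z ∧ x + n * c + c ∉ Z := by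
  by_contra! h
  have hmem : ∀ n : ℕ, x + n * c ∈ Z := by
    intro n
    induction n with
    | zero => simpa using hx
    | succ n ih =>
      have := h n ih
      rwa [add_assoc, ← add_one_mul, ← Nat.cast_succ] at this
  refine Set.infinite_of_injective_forall_mem (f := fun n : ℕ => x + n * c) ?_ hmem hZ
  intro a b hab
  simpa [hc] using hab

/-- A nonzero ideal of `K[X]` whose zero set can only be left by the shift `x ↦ x + 1` at points of
`A` and by the shift `x ↦ x - 1` at points of `B` is the unit ideal, if `A - B` avoids `ℕ`. -/
theorem Ideal.eq_top_of_shift [IsAlgClosed K] {J : Ideal K[X]} (hJ : J ≠ ⊥) (A B : Set K)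
    (hA : ∀ x : K, (∀ f ∈ J, f.eval x = 0) → x ∉ A → ∀ f ∈ J, f.eval (x + 1) = 0)
    (hB : ∀ x : K, (∀ f ∈ J, f.eval x = 0) → x ∉ B → ∀ f ∈ J, f.eval (x - 1) = 0)
    (hAB : ∀ a ∈ A, ∀ b ∈ B, ∀ n : ℕ, a - b ≠ n) : J = ⊤ := by
  apply Ideal.eq_top_of_no_common_root
  by_contra! h
  obtain ⟨x, hx⟩ := h
  set Z : Set K := {x | ∀ f ∈ J, f.eval x = 0}
  have hZ : Z.Finite := by
    obtain ⟨f, hf, hf0⟩ := Submodule.exists_mem_ne_zero_of_ne_bot hJ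
    classical
    exact (f.roots.toFinset.finite_toSet).subset fun y hy => by simpa [hf0] using hy f hf
  -- Walking up from a common root ends at a point of `A`, walking down ends at a point of `B`; they
  -- differ by the total number of steps.
  obtain ⟨n, hn, hn'⟩ := exists_last_mem_of_finite hZ (x := x) hx one_ne_zero
  obtain ⟨k, hk, hk'⟩ := exists_last_mem_of_finite hZ (x := x) hx (neg_ne_zero.mpr one_ne_zero)
  have ha : x + n * 1 ∈ A := by
    by_contra ha
    exact hn' (hA _ hn ha)
  have hb : x + k * -1 ∈ B := by
    by_contra hb
    exact hk' (by rw [← sub_eq_add_neg]; exact hB _ hk hb)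
  exact hAB _ ha _ hb (n + k) (by push_cast; ring)

end Shift

/-! ### Bijectivity of homomorphisms between cyclic modules. -/

section Equiv

variable {K : Type*} [Field K] {V V' : Type*} [AddCommGroup V] [Module K V]
  [LieRingModule (sl2 K) V] [AddCommGroup V'] [Module K V'] [LieRingModule (sl2 K) V']

theorem LieModuleHom.nonempty_equiv (φ : V →ₗ⁅K, sl2 K⁆ V') (h : Function.Bijective φ) :
    Nonempty (V' ≃ₗ⁅K, sl2 K⁆ V) := by
  obtain ⟨g, h1, h2⟩ := Function.bijective_iff_has_inverse.mp h
  exact ⟨LieModuleEquiv.symm { φ with invFun := g, left_inv := h1, right_inv := h2 }⟩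

theorem LieModuleHom.surjective_of_lieSpan (φ : V →ₗ⁅K, sl2 K⁆ V') {m : V}
    (h : LieSubmodule.lieSpan K (sl2 K) {φ m} = ⊤) : Function.Surjective φ := by
  rw [← LieModuleHom.range_eq_top, eq_top_iff, ← h, LieSubmodule.lieSpan_le,
    Set.singleton_subset_iff]
  exact ⟨m, rfl⟩

theorem LieModuleHom.mem_lieSpan (φ : V →ₗ⁅K, sl2 K⁆ V') {m : V}
    (h : LieSubmodule.lieSpan K (sl2 K) {m} = ⊤) (x : V) :
    φ x ∈ LieSubmodule.lieSpan K (sl2 K) {φ m} := by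
  have h1 : LieSubmodule.lieSpan K (sl2 K) {m} ≤
      (LieSubmodule.lieSpan K (sl2 K) {φ m}).comap φ := by
    rw [LieSubmodule.lieSpan_le, Set.singleton_subset_iff]
    exact LieSubmodule.subset_lieSpan rfl
  exact h1 (h ▸ LieSubmodule.mem_top x)

end Equiv

/-! ### Submodules of `N(α)` and irreducibility. -/

namespace N

variable {K : Type*} [Field K] {α : K}

theorem eq_top_of_v_mem {P : LieSubmodule K (sl2 K) (N α)} (h : ∀ k, v α k ∈ P) : P = ⊤ := by
  rw [eq_top_iff]
  rintro m -
  induction m using vu_induction with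
  | hv k => exact h k
  | hu k => rw [← polyAct_v]; exact LieSubmodule.polyAct_mem P _ (h k)
  | hadd x y hx hy => exact P.add_mem hx hy
  | hsmul c x hx => exact P.smul_mem c hx

theorem v_add_one_mem {P : LieSubmodule K (sl2 K) (N α)} {k : ℤ} (h : v α k ∈ P) :
    v α (k + 1) ∈ P := by
  rw [← polyAct_sq_v]; exact LieSubmodule.polyAct_mem P _ h

/-- Both `e₋₁ v_k = (e₀ + 1 - α) v_{k-1}` and `v_k = (e₀ + 1 - k)² v_{k-1}` lie in `P`, and the two
polynomials are coprime exactly when `α ≠ k`. -/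
theorem v_sub_one_mem {P : LieSubmodule K (sl2 K) (N α)} {k : ℤ} (hk : α ≠ k) (h : v α k ∈ P) :
    v α (k - 1) ∈ P := by
  refine LieSubmodule.mem_of_isCoprime P
    (isCoprime_X_add_C (a := 1 - α) (b := 1 - k) (by simpa using hk) 2) ?_ ?_
  · rw [← lie_neg_v_eq]; exact P.lie_mem h
  · have h1 := polyAct_sq_v (α := α) (k - 1)
    rw [sub_add_cancel] at h1
    rw [← h1] at h
    convert h using 4
    push_cast
    rw [C_sub, C_sub]
    ring

theorem eq_top_of_v_zero_mem (hα : ∀ n : ℤ, α ≠ n) {P : LieSubmodule K (sl2 K) (N α)}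
    (h : v α 0 ∈ P) : P = ⊤ := by
  refine eq_top_of_v_mem fun k => ?_
  induction k using Int.induction_on with
  | zero => exact h
  | succ k ih => exact v_add_one_mem ih
  | pred k ih => exact v_sub_one_mem (hα _) ih

/-- This is the rank one property: every vector is a `K[e₀]`-multiple of `v₀` up to a denominator,
and denominators can be multiplied together. -/
theorem exists_polyAct_eq_polyAct_v_zero (m : N α) :
    ∃ D : K[X], D ≠ 0 ∧ ∃ g : K[X], polyAct (N α) D m = polyAct (N α) g (v α 0) := by
  have hv : ∀ k : ℤ, ∃ D : K[X], D ≠ 0 ∧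
      ∃ g : K[X], polyAct (N α) D (v α k) = polyAct (N α) g (v α 0) := by
    intro k
    induction k using Int.induction_on with
    | zero => exact ⟨1, one_ne_zero, 1, rfl⟩
    | succ k ih =>
      obtain ⟨D, hD, g, h⟩ := ih
      refine ⟨D, hD, (X - C ((k : ℤ) : K)) ^ 2 * g, ?_⟩
      rw [← polyAct_sq_v, polyAct_comm, h, polyAct_mul]
    | pred k ih =>
      obtain ⟨D, hD, g, h⟩ := ih
      refine ⟨D * (X - C ((-(k : ℤ) - 1 : ℤ) : K)) ^ 2,
        mul_ne_zero hD (pow_ne_zero 2 (X_sub_C_ne_zero _)), g, ?_⟩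
      rw [polyAct_mul, polyAct_sq_v, sub_add_cancel, h]
  induction m using vu_induction with
  | hv k => exact hv k
  | hu k =>
    obtain ⟨D, hD, g, h⟩ := hv k
    refine ⟨D, hD, (X - C (k : K)) * g, ?_⟩
    rw [← polyAct_v, polyAct_comm, h, polyAct_mul]
  | hadd x y hx hy =>
    obtain ⟨D, hD, g, h⟩ := hx
    obtain ⟨D', hD', g', h'⟩ := hy
    refine ⟨D * D', mul_ne_zero hD hD', D' * g + D * g', ?_⟩
    rw [map_add, polyAct_mul, polyAct_mul, h', polyAct_comm, h, polyAct_add, polyAct_mul,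
      polyAct_mul]
  | hsmul c x hx =>
    obtain ⟨D, hD, g, h⟩ := hx
    refine ⟨D, hD, C c * g, ?_⟩
    rw [map_smul, h, polyAct_mul, polyAct_C]

/-- The polynomials `f` with `f(e₀) v₀ ∈ P`. -/
def polyIdeal (P : LieSubmodule K (sl2 K) (N α)) : Ideal K[X] where
  carrier := {f | polyAct (N α) f (v α 0) ∈ P}
  zero_mem' := by simp
  add_mem' := fun {f g} hf hg => by
    rw [Set.mem_ofPred_eq, polyAct_add]; exact P.add_mem hf hg
  smul_mem' := fun f g hg => by
    rw [Set.mem_ofPred_eq, smul_eq_mul, polyAct_mul]; exact LieSubmodule.polyAct_mem P f hg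

theorem mem_polyIdeal {P : LieSubmodule K (sl2 K) (N α)} {f : K[X]} :
    f ∈ polyIdeal P ↔ polyAct (N α) f (v α 0) ∈ P := Iff.rfl

theorem polyIdeal_ne_bot [IsAlgClosed K] {P : LieSubmodule K (sl2 K) (N α)} (hP : P ≠ ⊥) :
    polyIdeal P ≠ ⊥ := by
  obtain ⟨x, hxP, hx⟩ : ∃ x ∈ P, x ≠ 0 := by
    by_contra! h
    exact hP ((LieSubmodule.eq_bot_iff P).mpr h)
  obtain ⟨D, hD, g, h⟩ := exists_polyAct_eq_polyAct_v_zero x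
  refine (Submodule.ne_bot_iff _).mpr ⟨g, ?_, ?_⟩
  · rw [mem_polyIdeal, ← h]
    exact LieSubmodule.polyAct_mem P D hxP
  · rintro rfl
    exact hx (polyAct_injective hD (by rw [h]; simp))

theorem v_zero_mem_of_polyIdeal_eq_top {P : LieSubmodule K (sl2 K) (N α)} (h : polyIdeal P = ⊤) :
    v α 0 ∈ P := by
  have : (1 : K[X]) ∈ polyIdeal P := h ▸ Submodule.mem_top
  rwa [mem_polyIdeal, polyAct_one] at this

theorem lie_one_v_zero :
    ⁅sE_one K, v α 0⁆ = polyAct (N α) (X ^ 2 * (X - 1 + C α)) (v α 0) := by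
  have h := polyAct_sq_v (α := α) 0
  rw [Int.cast_zero, C_0, sub_zero] at h
  rw [lie_one_v_eq, ← h, ← polyAct_mul, mul_comm]

theorem lie_neg_polyAct_v_zero :
    ⁅sE_neg K, polyAct (N α) (X ^ 2 : K[X]) (v α 0)⁆ = polyAct (N α) (X + C (1 - α)) (v α 0) := by
  have h := polyAct_sq_v (α := α) 0
  rw [Int.cast_zero, C_0, sub_zero] at h
  rw [h, lie_neg_v_eq]
  rfl

theorem lie_neg_lie_zero_v_zero : ⁅sE_neg K, ⁅sE_zero K, v (0 : K) 0⁆⁆ = v 0 0 := by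
  rw [lie_zero_v, Int.cast_zero, zero_smul, zero_add]
  refine (lie_e_u (-1) 0).trans ?_
  simp

/-- Apply `e₋₁ e₀²` and `e₁` to `f(e₀) v₀`, and use the relations `q` and `p` satisfied by `v₀`. -/
theorem comp_mem_polyIdeal {P : LieSubmodule K (sl2 K) (N α)} {f : K[X]} (hf : f ∈ polyIdeal P) :
    f.comp (X + 1) * (X + C (1 - α)) ∈ polyIdeal P ∧
      f.comp (X - 1) * (X ^ 2 * (X - 1 + C α)) ∈ polyIdeal P := by
  rw [mem_polyIdeal] at *
  constructor
  · rw [polyAct_mul, ← lie_neg_polyAct_v_zero, ← lie_neg_polyAct, polyAct_comm]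
    exact P.lie_mem (LieSubmodule.polyAct_mem P _ hf)
  · rw [mem_polyIdeal, polyAct_mul, ← lie_one_v_zero, ← lie_one_polyAct]
    exact P.lie_mem hf

/-- A `W₁`-submodule of `N(α)`, regarded as an `sl₂`-submodule. -/
def restrictSl2 (P : LieSubmodule K (W1 K) (N α)) : LieSubmodule K (sl2 K) (N α) where
  toSubmodule := P.toSubmodule
  lie_mem := fun {x _} hm => P.lie_mem (x := (x : W1 K)) hm

theorem mem_restrictSl2 {P : LieSubmodule K (W1 K) (N α)} {m : N α} :
    m ∈ restrictSl2 P ↔ m ∈ P := Iff.rfl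

theorem isIrreducible_W1_of_v_zero_mem
    (hv : ∀ P : LieSubmodule K (sl2 K) (N α), P ≠ ⊥ → v α 0 ∈ P)
    (h : ∀ P : LieSubmodule K (W1 K) (N α), v α 0 ∈ P → restrictSl2 P = ⊤) :
    LieModule.IsIrreducible K (W1 K) (N α) := by
  have : Nontrivial (N α) := ⟨v α 0, 0, v_ne_zero 0⟩
  refine LieModule.IsIrreducible.mk fun P hP => ?_
  have hP' : restrictSl2 P ≠ ⊥ := by
    intro h0
    refine hP ((LieSubmodule.eq_bot_iff P).mpr fun m hm => ?_)
    exact (LieSubmodule.eq_bot_iff _).mp h0 m hm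
  have htop := h P (hv _ hP')
  rw [eq_top_iff]
  rintro m -
  exact mem_restrictSl2.mp (htop ▸ LieSubmodule.mem_top m)

variable [CharZero K] [IsAlgClosed K]

/-- The exceptional points are the roots of the extra factors in `comp_mem_polyIdeal`. Their
differences are `α - 1` and `2α - 2`, which are not integers. -/
theorem v_zero_mem (hα : ∀ n : ℤ, α ≠ n / 2) {P : LieSubmodule K (sl2 K) (N α)} (hP : P ≠ ⊥) :
    v α 0 ∈ P := by
  refine v_zero_mem_of_polyIdeal_eq_top (Ideal.eq_top_of_shift (polyIdeal_ne_bot hP) {α - 1}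
    {0, 1 - α} ?_ ?_ ?_)
  · intro x hx hxA f hf
    have h := hx _ (comp_mem_polyIdeal hf).1
    simp only [eval_mul, eval_comp, eval_add, eval_X, eval_one, eval_C, mul_eq_zero] at h
    refine h.resolve_right fun h => hxA ?_
    rw [Set.mem_singleton_iff]
    linear_combination h
  · intro x hx hxB f hf
    have h := hx _ (comp_mem_polyIdeal hf).2
    simp only [eval_mul, eval_comp, eval_add, eval_sub, eval_X, eval_one, eval_C, eval_pow,
      mul_eq_zero] at h
    refine h.resolve_right fun h => hxB ?_
    rcases h with h | h
    · exact Or.inl (pow_eq_zero_iff two_ne_zero |>.mp h)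
    · right
      rw [Set.mem_singleton_iff]
      linear_combination h
  · rintro a rfl b (rfl | rfl) n hn
    · refine hα (2 * (n + 1)) ?_
      push_cast
      linear_combination hn
    · refine hα (n + 2) ?_
      push_cast
      linear_combination hn / 2

/-- As `e₋₁ e₀ v₀ = v₀`, the ideal is stable under `f(X) ↦ f(X + 1)` with no extra factor. The
upward shift has no exceptions, so nothing is required of the downward one. -/
theorem v_zero_mem_of_zero {P : LieSubmodule K (sl2 K) (N (0 : K))} (hP : P ≠ ⊥) :
    v 0 0 ∈ P := by
  refine v_zero_mem_of_polyIdeal_eq_top (Ideal.eq_top_of_shift (polyIdeal_ne_bot hP) ∅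
    Set.univ ?_ (fun x _ h => absurd trivial h) (fun a ha => absurd ha (by simp)))
  intro x hx _ f hf
  have h : f.comp (X + 1) ∈ polyIdeal P := by
    rw [mem_polyIdeal] at *
    rw [← lie_neg_lie_zero_v_zero, ← lie_neg_polyAct, ← polyAct_X, polyAct_comm, polyAct_X]
    exact P.lie_mem (P.lie_mem hf)
  simpa using hx _ h

theorem isIrreducible_sl2 (hα : ∀ n : ℤ, α ≠ n / 2) : LieModule.IsIrreducible K (sl2 K) (N α) := by
  have : Nontrivial (N α) := ⟨v α 0, 0, v_ne_zero 0⟩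
  refine LieModule.IsIrreducible.mk fun P hP => eq_top_of_v_zero_mem (fun n hn => ?_)
    (v_zero_mem hα hP)
  exact hα (2 * n) (by rw [hn]; push_cast; ring)

theorem isIrreducible_W1 (hα : ∀ n : ℤ, α ≠ n / 2) : LieModule.IsIrreducible K (W1 K) (N α) :=
  isIrreducible_W1_of_v_zero_mem (fun _ hP => v_zero_mem hα hP) fun P hP =>
    (isIrreducible_sl2 hα).eq_bot_or_eq_top (restrictSl2 P) |>.resolve_left fun h =>
      v_ne_zero 0 ((LieSubmodule.eq_bot_iff _).mp h _ hP)

/-- For `α = 0`, `eₙ v₀ = uₙ` for every integer `n`, and `e₀` takes the `uₙ` to the remaining basis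
vectors. -/
theorem isIrreducible_W1_zero : LieModule.IsIrreducible K (W1 K) (N (0 : K)) := by
  refine isIrreducible_W1_of_v_zero_mem (fun _ hP => v_zero_mem_of_zero hP) fun P hP => ?_
  have hu : ∀ n, u 0 n ∈ P := by
    intro n
    have h := P.lie_mem (x := e K n) hP
    rw [lie_e_v] at h
    simpa using h
  refine eq_top_of_v_mem fun k => ?_
  have h := LieSubmodule.polyAct_mem (restrictSl2 P) (X - C ((k - 1 : ℤ) : K))
    (mem_restrictSl2.mpr (hu (k - 1)))
  rwa [polyAct_u, sub_add_cancel] at h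

/-- `N(α)` is the quotient of `U(γ)` by the left ideal generated by `p` and `q`. -/
theorem nonempty_equiv_leftQuot (hα : ∀ n : ℤ, α ≠ n / 2) {γ : K} (hγ : γ = α * (α - 1))
    (hp : N.rep α γ hγ (elP α γ) (N.v α 0) = 0) (hq : N.rep α γ hγ (elQ α γ) (N.v α 0) = 0) :
    Nonempty (N α ≃ₗ⁅K, sl2 K⁆
      LeftQuot (toUq γ) (Submodule.span (Uq γ) {elP α γ, elQ α γ})) := by
  set I := Submodule.span (Uq γ) {elP α γ, elQ α γ}
  have hαn : ∀ n : ℤ, α ≠ n := fun n hn => hα (2 * n) (by rw [hn]; push_cast; ring)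
  obtain ⟨φ, hφ⟩ := LeftQuot.exists_hom (j := toUq γ) (N.rep α γ hγ)
    (fun x m => rep_uι α γ hγ x m) (S := {elP α γ, elQ α γ}) (v := v α 0)
    (by rintro s (rfl | rfl) <;> assumption)
  refine LieModuleHom.nonempty_equiv φ ⟨?_, ?_⟩
  · rw [injective_iff_map_eq_zero]
    intro x hx
    have hgen := LeftQuot.lieSpan_one (toUq_surjective γ) I
    have h1 : ⁅sE_one K, LeftQuot.one (toUq γ) I⁆ =
        polyAct _ (X ^ 2 * (X - 1 + C α)) (LeftQuot.one (toUq γ) I) := by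
      have h := LeftQuot.smul_one_eq_zero (j := toUq γ) (I := I)
        (Submodule.subset_span (Set.mem_insert (elP α γ) {elQ α γ}))
      rw [elP, sub_smul, sub_eq_zero] at h
      refine h.trans ?_
      rw [LeftQuot.polyAct_eq]
      simp only [map_mul, map_add, map_sub, map_pow, aeval_X, aeval_C, map_one]
      rfl
    have h2 : ⁅sE_neg K, polyAct _ (X ^ 2 : K[X]) (LeftQuot.one (toUq γ) I)⁆ =
        polyAct _ (X + C (1 - α)) (LeftQuot.one (toUq γ) I) := by
      have h := LeftQuot.smul_one_eq_zero (j := toUq γ) (I := I)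
        (Submodule.subset_span (Set.mem_insert_of_mem (elP α γ) (Set.mem_singleton (elQ α γ))))
      rw [elQ, sub_smul, sub_eq_zero, mul_smul] at h
      rw [LeftQuot.polyAct_eq, LeftQuot.polyAct_eq]
      simp only [map_pow, map_add, map_sub, aeval_X, aeval_C, map_one, ← add_sub_assoc]
      exact h
    obtain ⟨y, f, g, hf, hg⟩ := exists_eq_polyAct_chain (LeftQuot.hasCasimir I)
      (fun n hn => hαn (-n) (by rw [hn]; push_cast; rfl)) h1 h2
      (hgen ▸ LieSubmodule.mem_top x)
    -- Since `g(e₀) φ(y) = v₀`, the vector `φ(y)` is nonzero; torsion-freeness then turns `f(e₀)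
    -- φ(y) = 0` into `f = 0`.
    have hy : φ y ≠ 0 := by
      intro hy
      refine v_ne_zero (α := α) 0 ?_
      rw [← hφ, ← hg, LieModuleHom.map_polyAct, hy, map_zero]
    rw [hf, LieModuleHom.map_polyAct] at hx
    have hf0 : f = 0 := by
      by_contra hf0
      exact hy (polyAct_injective hf0 hx)
    rw [hf, hf0, map_zero, LinearMap.zero_apply]
  · refine LieModuleHom.surjective_of_lieSpan φ (m := LeftQuot.one (toUq γ) I) ?_
    rw [hφ]
    exact eq_top_of_v_zero_mem hαn (LieSubmodule.subset_lieSpan rfl)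

/-! ### The basis and presentation of `M`, and generation of `N(0)/M`. -/

section General

variable {K : Type*} [Field K] {α : K}

/-- `m = w k + (a combination of the w j with j < k)`. -/
def HasTop (m : N α) (k : ℤ) : Prop :=
  (basisW α).repr m k = 1 ∧ ∀ j, k < j → (basisW α).repr m j = 0

theorem hasTop_v_zero : HasTop (v α 0) 0 := by
  have h : v α 0 = basisW α 0 := by rw [← basisW_two_mul, mul_zero]
  rw [HasTop, h, Module.Basis.repr_self]
  exact ⟨Finsupp.single_eq_same, fun j hj => Finsupp.single_eq_of_ne hj.ne'⟩

theorem HasTop.lie_zero {m : N α} {k : ℤ} (h : HasTop m k) : HasTop ⁅sE_zero K, m⁆ (k + 1) := by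
  refine ⟨?_, fun j hj => ?_⟩
  · rw [repr_lie_zero, h.1, h.2 _ (by omega), mul_zero, zero_add]
  · obtain ⟨i, rfl⟩ : ∃ i, j = i + 1 := ⟨j - 1, by ring⟩
    rw [repr_lie_zero, h.2 _ (by omega), h.2 _ (by omega), mul_zero, zero_add]

theorem HasTop.lie_neg {m : N α} {k : ℤ} (h : HasTop m k) : HasTop ⁅sE_neg K, m⁆ (k - 1) := by
  refine ⟨?_, fun j hj => ?_⟩
  · rw [repr_lie_neg, sub_add_cancel, h.1, h.2 _ (by omega), mul_zero, zero_add]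
  · rw [repr_lie_neg, h.2 _ (by omega), h.2 _ (by omega), mul_zero, zero_add]

theorem linearIndependent_of_hasTop {c : ℤ → N α} (hc : ∀ k, HasTop (c k) k) :
    LinearIndependent K c := by
  rw [linearIndependent_iff]
  intro l hl
  by_contra hne
  have hs : l.support.Nonempty := Finsupp.support_nonempty_iff.mpr hne
  have hn : l (l.support.max' hs) ≠ 0 := Finsupp.mem_support_iff.mp (l.support.max'_mem hs)
  set n := l.support.max' hs with hn_def
  have h := congrArg (fun m => (basisW α).repr m n) hl
  simp only [Finsupp.linearCombination_apply, Finsupp.sum, map_sum, map_smul, map_zero,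
    Finsupp.coe_finsetSum, Finset.sum_apply, Finsupp.smul_apply, smul_eq_mul,
    Finsupp.zero_apply] at h
  rw [Finset.sum_eq_single n, (hc n).1, mul_one] at h
  · exact hn h
  · intro i hi hin
    rw [(hc i).2 n (lt_of_le_of_ne (l.support.le_max' i hi) hin), mul_zero]
  · intro h'
    exact absurd (l.support.max'_mem hs) h'

/-- The vectors `e₀ⁿ v₀` (at `n ≥ 0`) and `e₋₁ⁿ v₀` (at `-n ≤ 0`). -/
def genM (K : Type*) [Field K] : ℤ → N (0 : K)
  | .ofNat n => (toEnd K (sl2 K) (N (0 : K)) (sE_zero K) ^ n) (v 0 0)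
  | .negSucc n => negPow (K := K) (v 0 0) (n + 1)

theorem genM_natCast (n : ℕ) :
    genM K n = (toEnd K (sl2 K) (N (0 : K)) (sE_zero K) ^ n) (v 0 0) := rfl

theorem genM_neg (n : ℕ) : genM K (-n) = negPow (K := K) (v 0 0) n := by
  cases n with
  | zero => rfl
  | succ n => rfl

theorem genM_natCast_succ (n : ℕ) : genM K (n + 1) = ⁅sE_zero K, genM K n⁆ := by
  rw [← Nat.cast_succ, genM_natCast, pow_succ', genM_natCast]; rfl

theorem hasTop_genM (k : ℤ) : HasTop (genM K k) k := by
  induction k using Int.induction_on with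
  | zero => exact hasTop_v_zero
  | succ k ih => rw [genM_natCast_succ]; exact ih.lie_zero
  | pred k ih =>
    have h : -(k : ℤ) - 1 = -((k + 1 : ℕ) : ℤ) := by push_cast; ring
    rw [h, genM_neg, negPow_succ, ← h, ← genM_neg]
    exact ih.lie_neg

theorem hasCasimir_zero : HasCasimir K (N (0 : K)) 0 := by
  have h := hasCasimir (0 : K)
  rwa [zero_mul] at h

theorem rep_uι_eq_toEnd {γ : K} (h : γ = α * (α - 1)) (x : sl2 K) :
    N.rep α γ h (uι γ x) = toEnd K (sl2 K) (N α) x :=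
  LinearMap.ext fun m => rep_uι α γ h x m

theorem v_zero_mem_M : v (0 : K) 0 ∈ M K := LieSubmodule.subset_lieSpan rfl

theorem genM_mem (k : ℤ) : genM K k ∈ M K := by
  induction k using Int.induction_on with
  | zero => exact v_zero_mem_M
  | succ k ih => rw [genM_natCast_succ]; exact (M K).lie_mem ih
  | pred k ih =>
    have h : -(k : ℤ) - 1 = -((k + 1 : ℕ) : ℤ) := by push_cast; ring
    rw [h, genM_neg, negPow_succ, ← genM_neg]
    exact (M K).lie_mem ih

/-- On the negative side, `e₀ e₋₁ⁿ⁺¹ v₀ = e₋₁ⁿ v₀ - (n + 1) e₋₁ⁿ⁺¹ v₀`. -/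
theorem lie_zero_genM_mem (k : ℤ) :
    ⁅sE_zero K, genM K k⁆ ∈ Submodule.span K (Set.range (genM K)) := by
  have hmem : ∀ k, genM K k ∈ Submodule.span K (Set.range (genM K)) :=
    fun k => Submodule.subset_span ⟨k, rfl⟩
  obtain ⟨n, rfl | rfl⟩ := k.eq_nat_or_neg
  · rw [← genM_natCast_succ]; exact hmem _
  · cases n with
    | zero => exact genM_natCast_succ (K := K) 0 ▸ hmem _
    | succ n =>
      have h := polyAct_negPow (lie_neg_lie_zero_v_zero (K := K)) n
      rw [polyAct_add, polyAct_C, polyAct_X, ← genM_neg, ← genM_neg] at h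
      rw [eq_sub_of_add_eq h]
      exact Submodule.sub_mem _ (hmem _) (Submodule.smul_mem _ _ (hmem _))

theorem mem_span_genM {m : N (0 : K)} (hm : m ∈ M K) :
    m ∈ Submodule.span K (Set.range (genM K)) := by
  obtain ⟨n, f, rfl⟩ := exists_eq_polyAct_negPow hasCasimir_zero lie_neg_lie_zero_v_zero hm
  clear hm
  induction f using polyAct_induction with
  | hC c =>
    rw [polyAct_C, ← genM_neg]
    exact Submodule.smul_mem _ c (Submodule.subset_span ⟨_, rfl⟩)
  | hadd f g hf hg => rw [polyAct_add]; exact Submodule.add_mem _ hf hg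
  | hX f hf =>
    rw [polyAct_mul, polyAct_X]
    generalize polyAct (N (0 : K)) f (negPow (K := K) (v 0 0) n) = y at hf
    induction hf using Submodule.span_induction with
    | mem y hy => obtain ⟨k, rfl⟩ := hy; exact lie_zero_genM_mem k
    | zero => rw [lie_zero]; exact Submodule.zero_mem _
    | add a b _ _ ha hb => rw [lie_add]; exact Submodule.add_mem _ ha hb
    | smul c a _ ha => rw [lie_smul]; exact Submodule.smul_mem _ c ha

/-- The basis `e₀ⁿ v₀, e₋₁ⁿ v₀` of `M`. -/
theorem exists_basis_M : ∃ b : Module.Basis ℤ K (M K), ∀ k, (b k : N (0 : K)) = genM K k := by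
  let c : ℤ → M K := fun k => ⟨genM K k, genM_mem k⟩
  have hli : LinearIndependent K c :=
    LinearIndependent.of_comp (M K).toSubmodule.subtype
      (linearIndependent_of_hasTop (K := K) hasTop_genM)
  have hspan : ⊤ ≤ Submodule.span K (Set.range c) := by
    rintro ⟨m, hm⟩ -
    have h := mem_span_genM hm
    have himg : Set.range (genM K) = (M K).toSubmodule.subtype '' Set.range c := by
      rw [← Set.range_comp]; rfl
    rw [himg, Submodule.span_image] at h
    obtain ⟨y, hy, hym⟩ := h
    have : y = ⟨m, hm⟩ := Subtype.ext hym
    exact this ▸ hy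
  exact ⟨Module.Basis.mk hli hspan, fun k => by rw [Module.Basis.mk_apply]⟩

/-- The class of `v₋₁` in `N(0) / M`. -/
def topVec (K : Type*) [Field K] : N (0 : K) ⧸ M K := LieSubmodule.Quotient.mk' (M K) (v 0 (-1))

theorem lie_one_topVec : ⁅sE_one K, topVec K⁆ = 0 := by
  rw [topVec, ← LieModuleHom.map_lie, LieSubmodule.Quotient.mk_eq_zero, lie_one_v_eq,
    neg_add_cancel]
  exact LieSubmodule.polyAct_mem _ _ v_zero_mem_M

/-- The error term is `(e₀ + 1) v₋₁ = u₋₁ = e₋₁ v₀`, which lies in `M`. -/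
theorem lie_zero_topVec : ⁅sE_zero K, topVec K⁆ = (-1 : K) • topVec K := by
  rw [topVec, ← LieModuleHom.map_lie, ← map_smul, ← sub_eq_zero, ← map_sub,
    LieSubmodule.Quotient.mk_eq_zero]
  have h : ⁅sE_zero K, v (0 : K) (-1)⁆ - (-1 : K) • v 0 (-1) = ⁅sE_neg K, v (0 : K) 0⁆ := by
    rw [lie_zero_v, lie_neg_v]
    simp
  rw [h]
  exact (M K).lie_mem v_zero_mem_M

/-- `M` is the quotient of `U(0)` by the left ideal generated by `s`. -/
theorem nonempty_M_equiv_leftQuot [IsAlgClosed K] (h0 : (0 : K) = 0 * (0 - 1))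
    (hs : N.rep 0 0 h0 (elS K) (N.v 0 0) = 0) :
    Nonempty (M K ≃ₗ⁅K, sl2 K⁆ LeftQuot (toUq 0) (Submodule.span (Uq (0 : K)) {elS K})) := by
  set I := Submodule.span (Uq (0 : K)) {elS K}
  obtain ⟨φ, hφ⟩ := LeftQuot.exists_hom (j := toUq (0 : K)) (N.rep 0 0 h0)
    (fun x m => rep_uι 0 0 h0 x m) (S := {elS K}) (v := v 0 0) (by rintro s rfl; exact hs)
  have hgen := LeftQuot.lieSpan_one (toUq_surjective (0 : K)) I
  have hmem : ∀ x, φ x ∈ M K := by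
    intro x
    have h := LieModuleHom.mem_lieSpan φ hgen x
    rwa [hφ] at h
  refine LieModuleHom.nonempty_equiv (φ.codRestrict (M K) hmem) ⟨?_, ?_⟩
  · rw [injective_iff_map_eq_zero]
    intro x hx
    have hx' : φ x = 0 := congrArg Subtype.val hx
    have hone : ⁅sE_neg K, ⁅sE_zero K, LeftQuot.one (toUq 0) I⁆⁆ = LeftQuot.one (toUq 0) I := by
      have h := LeftQuot.smul_one_eq_zero (j := toUq (0 : K)) (I := I)
        (Submodule.subset_span (Set.mem_singleton (elS K)))
      rw [elS, sub_smul, sub_eq_zero, mul_smul, one_smul] at h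
      exact h
    obtain ⟨n, f, hf⟩ := exists_eq_polyAct_negPow (LeftQuot.hasCasimir I) hone
      (hgen ▸ LieSubmodule.mem_top x)
    have hne : φ (negPow (K := K) (LeftQuot.one (toUq 0) I) n) ≠ 0 := by
      clear hf
      induction n with
      | zero => rw [negPow_zero, hφ]; exact v_ne_zero 0
      | succ n ih =>
        intro h
        refine ih ?_
        rw [← polyAct_negPow hone, LieModuleHom.map_polyAct, h, map_zero]
    rw [hf, LieModuleHom.map_polyAct] at hx'
    have hf0 : f = 0 := by
      by_contra hf0
      exact hne (polyAct_injective hf0 hx')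
    rw [hf, hf0, map_zero, LinearMap.zero_apply]
  · have hle : M K ≤ φ.range := by
      rw [M, LieSubmodule.lieSpan_le, Set.singleton_subset_iff]
      exact ⟨_, hφ⟩
    rintro ⟨y, hy⟩
    obtain ⟨x, hx⟩ := hle hy
    exact ⟨x, Subtype.ext hx⟩

/-- Descending from `v_k` to `v_{k-1}` is obstructed only at `k = α = 0`, so `v₋₁` reaches all lower
indices; the others already lie in `M`. -/
theorem lieSpan_topVec [CharZero K] : LieSubmodule.lieSpan K (sl2 K) {topVec K} = ⊤ := by
  set P := LieSubmodule.lieSpan K (sl2 K) {topVec K}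
  have hcomap : P.comap (LieSubmodule.Quotient.mk' (M K)) = ⊤ := by
    have hm : ∀ {m}, m ∈ M K → m ∈ P.comap (LieSubmodule.Quotient.mk' (M K)) := by
      intro m hm
      rw [LieSubmodule.mem_comap, (LieSubmodule.Quotient.mk_eq_zero _).mpr hm]
      exact P.zero_mem
    refine eq_top_of_v_mem fun k => ?_
    have hneg : ∀ n : ℕ, v 0 (-1 - n) ∈ P.comap (LieSubmodule.Quotient.mk' (M K)) := by
      intro n
      induction n with
      | zero => exact LieSubmodule.subset_lieSpan rfl
      | succ n ih =>
        have hn : (0 : K) ≠ ((-1 - n : ℤ) : K) := by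
          intro h
          have : (-1 - n : ℤ) = 0 := by exact_mod_cast h.symm
          omega
        have := v_sub_one_mem hn ih
        rwa [sub_sub] at this
    have hpos : ∀ n : ℕ, v 0 n ∈ P.comap (LieSubmodule.Quotient.mk' (M K)) := by
      intro n
      induction n with
      | zero => exact hm v_zero_mem_M
      | succ n ih => exact v_add_one_mem ih
    rcases le_or_gt 0 k with hk | hk
    · lift k to ℕ using hk
      exact hpos k
    · obtain ⟨n, hn⟩ := Int.eq_ofNat_of_zero_le (show 0 ≤ -1 - k by omega)
      have := hneg n
      rwa [← hn, sub_sub_cancel] at this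
  rw [eq_top_iff]
  rintro x -
  obtain ⟨m, rfl⟩ := LieSubmodule.Quotient.surjective_mk' (M K) x
  have : m ∈ P.comap (LieSubmodule.Quotient.mk' (M K)) := hcomap ▸ LieSubmodule.mem_top m
  exact this

end General

/-! ### Simplicity of `M` and the Verma quotient. -/

section AlgClosed

variable {K : Type*} [Field K] [CharZero K] [IsAlgClosed K]

theorem isIrreducible_M : LieModule.IsIrreducible K (sl2 K) (M K) := by
  have : Nontrivial (M K) :=
    ⟨⟨v 0 0, v_zero_mem_M⟩, 0, fun h => v_ne_zero (α := (0 : K)) 0 (congrArg Subtype.val h)⟩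
  refine LieModule.IsIrreducible.mk fun P hP => ?_
  have hne : P.map (M K).incl ≠ ⊥ := by
    intro h
    refine hP ((LieSubmodule.eq_bot_iff P).mpr fun m hm => ?_)
    exact Subtype.ext ((LieSubmodule.eq_bot_iff _).mp h m
      ((LieSubmodule.mem_map _).mpr ⟨m, hm, rfl⟩))
  have hle : M K ≤ P.map (M K).incl :=
    LieSubmodule.lieSpan_le.mpr (Set.singleton_subset_iff.mpr (v_zero_mem_of_zero hne))
  rw [eq_top_iff]
  rintro ⟨x, hx⟩ -
  obtain ⟨y, hy, hyx⟩ := (LieSubmodule.mem_map _).mp (hle hx)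
  have : y = ⟨x, hx⟩ := Subtype.ext hyx
  exact this ▸ hy

/-- If `v₋₁ = f(e₀) e₋₁ⁿ v₀`, write `v₀` both as `(e₀ + 1)² v₋₁` and as `(e₀ + 1)⋯(e₀ + n) e₋₁ⁿ v₀`.
Torsion-freeness gives `(X + 1)⋯(X + n) = f (X + 1)²`, but `-1` is at most a simple root of the left
side. -/
theorem v_neg_one_notMem_M : v (0 : K) (-1) ∉ M K := by
  intro h
  obtain ⟨n, f, hf⟩ := exists_eq_polyAct_negPow hasCasimir_zero lie_neg_lie_zero_v_zero h
  have hD : polyAct (N (0 : K)) (∏ i ∈ Finset.range n, (X + C (i + 1 : K)))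
      (negPow (K := K) (v 0 0) n) = v 0 0 := by
    clear hf
    induction n with
    | zero => rw [Finset.prod_range_zero, polyAct_one, negPow_zero]
    | succ n ih =>
      rw [Finset.prod_range_succ, polyAct_mul, polyAct_negPow lie_neg_lie_zero_v_zero, ih]
  have hsq := polyAct_sq_v (α := (0 : K)) (-1)
  rw [neg_add_cancel] at hsq
  have heq : ∏ i ∈ Finset.range n, (X + C (i + 1 : K)) = f * (X - C ((-1 : ℤ) : K)) ^ 2 := by
    rw [← polyAct_eq_iff (v_ne_zero (α := (0 : K)) (-1)), polyAct_mul, hsq, ← hD, polyAct_comm f,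
      ← hf]
  have hX : (X - C ((-1 : ℤ) : K)) = X + 1 := by simp
  rw [hX] at heq
  cases n with
  | zero =>
    have := congrArg (eval (-1)) heq
    simp at this
  | succ n =>
    -- Split off the factor `X + 1` at index `0` and cancel it; at `-1` the remaining factors take
    -- the nonzero values `i + 1`.
    rw [Finset.prod_range_succ', Nat.cast_zero, zero_add, C_1, pow_two, ← mul_assoc] at heq
    have hne : (X + 1 : K[X]) ≠ 0 := X_add_C_ne_zero 1
    have := congrArg (eval (-1)) (mul_right_cancel₀ hne heq)
    rw [eval_prod, eval_mul, eval_add, eval_X, eval_one, neg_add_cancel, mul_zero,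
      Finset.prod_eq_zero_iff] at this
    obtain ⟨i, -, hi⟩ := this
    simp only [eval_add, eval_X, eval_C, Nat.cast_add, Nat.cast_one] at hi
    have hi' : ((i + 1 : ℕ) : K) = 0 := by push_cast; linear_combination hi
    exact i.succ_ne_zero (Nat.cast_eq_zero.mp hi')

theorem topVec_ne_zero : topVec K ≠ 0 := by
  rw [topVec, Ne, LieSubmodule.Quotient.mk_eq_zero]
  exact v_neg_one_notMem_M

/-- The Verma module is simple by the same highest weight criterion, its generator being nonzero
because it maps to `topVec K`. A nonzero homomorphism from it is therefore injective, and this one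
hits a generator. -/
theorem nonempty_quotient_equiv_verma :
    Nonempty ((N (0 : K) ⧸ M K) ≃ₗ⁅K, sl2 K⁆ Verma (-1 : K)) := by
  let ρ : U K →ₐ[K] Module.End K (N (0 : K) ⧸ M K) :=
    UniversalEnvelopingAlgebra.lift K (toEnd K (sl2 K) (N (0 : K) ⧸ M K))
  have hρ : ∀ x m, ρ (UniversalEnvelopingAlgebra.ι K x) m = ⁅x, m⁆ := by
    intro x m
    simp only [ρ, UniversalEnvelopingAlgebra.lift_ι_apply]
    rfl
  set S : Set (U K) := {UniversalEnvelopingAlgebra.ι K (sE_one K),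
    UniversalEnvelopingAlgebra.ι K (sE_zero K) - algebraMap K (U K) (-1)}
  set I := Submodule.span (U K) S
  obtain ⟨φ, hφ⟩ := LeftQuot.exists_hom (j := AlgHom.id K (U K)) ρ hρ (S := S) (v := topVec K) (by
    rintro s (rfl | rfl)
    · rw [hρ, lie_one_topVec]
    · rw [map_sub, LinearMap.sub_apply, hρ, lie_zero_topVec, AlgHom.commutes,
        Module.algebraMap_end_apply, sub_self])
  have hgen := LeftQuot.lieSpan_one (j := AlgHom.id K (U K)) Function.surjective_id I
  have hne : LeftQuot.one (AlgHom.id K (U K)) I ≠ 0 := by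
    intro h
    rw [h, map_zero] at hφ
    exact topVec_ne_zero hφ.symm
  have hirr : LieModule.IsIrreducible K (sl2 K) (LeftQuot (AlgHom.id K (U K)) I) := by
    refine isIrreducible_of_highestWeight hne ?_ ?_ hgen
    · exact LeftQuot.smul_one_eq_zero (Submodule.subset_span (Set.mem_insert _ _))
    · have h := LeftQuot.smul_one_eq_zero (j := AlgHom.id K (U K)) (I := I)
        (Submodule.subset_span (Set.mem_insert_of_mem _ (Set.mem_singleton _)))
      rw [sub_smul, sub_eq_zero, algebraMap_smul] at h
      exact h
  refine LieModuleHom.nonempty_equiv φ ⟨?_, ?_⟩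
  · rw [← LieModuleHom.ker_eq_bot]
    refine (hirr.eq_bot_or_eq_top φ.ker).resolve_right fun h => topVec_ne_zero (K := K) ?_
    rw [← hφ, ← LieModuleHom.mem_ker, h]
    exact LieSubmodule.mem_top _
  · refine LieModuleHom.surjective_of_lieSpan φ (m := LeftQuot.one _ I) ?_
    rw [hφ]
    exact lieSpan_topVec

end AlgClosed

end N

end CircleGauge

end

open CircleGauge
theorem theorem13 (K : Type*) [Field K] [IsAlgClosed K] [CharZero K] :
    -- Part (a)
    (N.rep 0 0 (by simp) (elS K) (N.v 0 0) = 0 ∧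
      LieModule.IsIrreducible K (sl2 K) (M K) ∧
      Nonempty (M K ≃ₗ⁅K, sl2 K⁆ LeftQuot (toUq 0) (Submodule.span (Uq (0 : K)) {elS K})) ∧
      (∃ b : Module.Basis ℤ K (M K),
        (∀ n : ℕ, (b n : N (0 : K)) =
          (LieModule.toEnd K (W1 K) (N (0 : K)) (e K 0) ^ n) (N.v 0 0)) ∧
        (∀ n : ℕ, 1 ≤ n → (b (-(n : ℤ)) : N (0 : K)) =
          (LieModule.toEnd K (W1 K) (N (0 : K)) (e K (-1)) ^ n) (N.v 0 0))) ∧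
      LieModule.IsIrreducible K (sl2 K) (N (0 : K) ⧸ M K) ∧
      IsHighestWeight (N (0 : K) ⧸ M K) (-1 : K) ∧
      Nonempty ((N (0 : K) ⧸ M K) ≃ₗ⁅K, sl2 K⁆ Verma (-1 : K)) ∧
      LieModule.IsIrreducible K (W1 K) (N (0 : K))) ∧
    -- Part (b)
    (∀ α : K, (∀ n : ℤ, α ≠ (n : K) / 2) → ∀ (γ : K) (hγ : γ = α * (α - 1)),
      N.rep α γ hγ (elP α γ) (N.v α 0) = 0 ∧
      N.rep α γ hγ (elQ α γ) (N.v α 0) = 0 ∧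
      LieModule.IsIrreducible K (sl2 K) (N α) ∧
      Nonempty (N α ≃ₗ⁅K, sl2 K⁆
        LeftQuot (toUq γ) (Submodule.span (Uq γ) {elP α γ, elQ α γ})) ∧
      LieModule.IsIrreducible K (W1 K) (N α)) := by
  refine ⟨?_, fun α hα γ hγ => ?_⟩
  · have hs : N.rep 0 0 (by simp) (elS K) (N.v 0 0) = 0 := by
      rw [elS, map_sub, map_mul, map_one, LinearMap.sub_apply, Module.End.mul_apply, N.rep_uι,
        N.rep_uι, Module.End.one_apply, sub_eq_zero]
      exact N.lie_neg_lie_zero_v_zero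
    refine ⟨hs, N.isIrreducible_M, N.nonempty_M_equiv_leftQuot _ hs, ?_,
      isIrreducible_of_highestWeight N.topVec_ne_zero N.lie_one_topVec N.lie_zero_topVec
        N.lieSpan_topVec,
      ⟨N.topVec K, N.topVec_ne_zero, N.lie_one_topVec, N.lie_zero_topVec, N.lieSpan_topVec⟩,
      N.nonempty_quotient_equiv_verma, N.isIrreducible_W1_zero⟩
    obtain ⟨b, hb⟩ := N.exists_basis_M (K := K)
    exact ⟨b, fun n => (hb n).trans (N.genM_natCast n), fun n _ => (hb _).trans (N.genM_neg n)⟩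
  · have hp : N.rep α γ hγ (elP α γ) (N.v α 0) = 0 := by
      rw [elP, map_sub, map_mul, map_pow, map_add, map_sub, map_one, AlgHom.commutes,
        LinearMap.sub_apply, N.rep_uι, sub_eq_zero]
      refine N.lie_one_v_zero.trans ?_
      simp only [polyAct, map_mul, map_pow, map_add, map_sub, map_one, Polynomial.aeval_X,
        Polynomial.aeval_C, N.rep_uι_eq_toEnd]
    have hq : N.rep α γ hγ (elQ α γ) (N.v α 0) = 0 := by
      rw [elQ, map_sub, map_mul, map_pow, map_sub, map_add, map_one, AlgHom.commutes,
        LinearMap.sub_apply, Module.End.mul_apply, N.rep_uι, sub_eq_zero]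
      have h := N.lie_neg_polyAct_v_zero (α := α)
      simp only [polyAct, map_pow, map_add, map_sub, map_one, Polynomial.aeval_X,
        Polynomial.aeval_C, ← add_sub_assoc] at h
      rw [N.rep_uι_eq_toEnd]
      exact h
    exact ⟨hp, hq, N.isIrreducible_sl2 hα, N.nonempty_equiv_leftQuot hα hγ hp hq,
      N.isIrreducible_W1 hα⟩
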